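/- Let a kite be a graph with four vertices $a,b,c,d$ and the four edges $ab,ac,bc,cd$. A kite packing of order $v$ is a pair $(X,\mathcal B)$, where $X$ is the vertex set of the complete graph $K_v$ and $\mathcal B$ is a collection of subgraphs (blocks) of $K_v$, each isomorphic to the kite, such that each edge of $K_v$ belongs to at most one block. It is maximum if no kite packing $(X,\mathcal B')$ has $|\mathcal B'|>|\mathcal B|$. Let $T(\mathcal B)$ be the set of all triangles (as $3$-element vertex sets) contained in the blocks of $\mathcal B$, and let $$\mathrm{Fin}(v)=\{(s,t): \text{there are maximum kite packings } (X,\mathcal B_1),(X,\mathcal B_2) \text{ of order } v \text{ with } |\mathcal B_1\cap\mathcal B_2|=s \text{ and } |T(\mathcal B_1)\cap T(\mathcal B_2)|=s+t\}.$$ Let $b_v=\lfloor v(v-1)/8\rfloor$ and $\mathrm{Adm}(v)=\{(s,t): s,t \text{ are non-negative integers and } s+t\le b_v\}$. Then $$\mathrm{Fin}(v)=\mathrm{Adm}(v)\setminus\{(b_v-1,0),(b_v-1,1)\}\quad\text{for every integer } v\equiv 0,1 \pmod 8,\ v\ge 8,$$ $$\mathrm{Fin}(v)=\mathrm{Adm}(v)\quad\text{for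 every integer } v\equiv 2,3,4,5,6,7 \pmod 8,\ v\ge 4.$$ -/

import Mathlib

/-- The kite: the graph on four vertices `0, 1, 2, 3` with the four edges `01, 02, 12, 23`,
that is, a triangle with a pendant edge. -/
def kite : SimpleGraph (Fin 4) :=
  SimpleGraph.fromEdgeSet {s(0, 1), s(0, 2), s(1, 2), s(2, 3)}

/-- `IsPacking G ℬ`: the collection `ℬ` of subgraphs (blocks) of the complete graph on the finite
vertex set `X` is a `G`-packing: each block is isomorphic to `G`, and each edge of the complete
graph belongs to at most one block. -/
structure IsPacking {W X : Type*} [Finite X] (G : SimpleGraph W)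
    (ℬ : Set (⊤ : SimpleGraph X).Subgraph) : Prop where
  iso : ∀ B ∈ ℬ, Nonempty (B.coe ≃g G)
  edge : ∀ e ∈ (⊤ : SimpleGraph X).edgeSet, {B | B ∈ ℬ ∧ e ∈ B.edgeSet}.Subsingleton

/-- A packing is maximum if no packing with the same vertex set has more blocks.
As `X` is finite, there are finitely many subgraphs, so `Set.ncard` is the true cardinality. -/
structure IsMaximumPacking {W X : Type*} [Finite X] (G : SimpleGraph W)
    (ℬ : Set (⊤ : SimpleGraph X).Subgraph) : Prop where
  isPacking : IsPacking G ℬ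
  maximum : ∀ ℬ' : Set (⊤ : SimpleGraph X).Subgraph, IsPacking G ℬ' → ℬ'.ncard ≤ ℬ.ncard

/-- The set `T(ℬ)` of all triangles contained in some block of `ℬ`. A triangle is given by
its vertex set, three pairwise adjacent vertices of the block. -/
def triangles {X : Type*} (ℬ : Set (⊤ : SimpleGraph X).Subgraph) : Set (Finset X) :=
  ⋃ B ∈ ℬ, B.spanningCoe.cliqueSet 3

/-- `Fin(v)`: the pairs `(s, t)` such that two maximum kite packings on a common vertex set of
size `v` intersect in `s` blocks and in `s + t` triangles. -/
def kiteFin (v : ℕ) : Set (ℕ × ℕ) :=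
  {p | ∃ ℬ₁ ℬ₂ : Set (⊤ : SimpleGraph (Fin v)).Subgraph,
    IsMaximumPacking kite ℬ₁ ∧ IsMaximumPacking kite ℬ₂ ∧
    (ℬ₁ ∩ ℬ₂).ncard = p.1 ∧ (triangles ℬ₁ ∩ triangles ℬ₂).ncard = p.1 + p.2}

/-- `b_v = ⌊v(v-1)/8⌋`. -/
def kiteB (v : ℕ) : ℕ := v * (v - 1) / 8

/-- `Adm(v)`: the pairs `(s, t)` of non-negative integers with `s + t ≤ b_v`. -/
def kiteAdm (v : ℕ) : Set (ℕ × ℕ) := {p | p.1 + p.2 ≤ kiteB v}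

/-!
A packing of `K_v` has at most `b = kiteB v` kites, because every kite has four edges; this gives
`Fin(v) ⊆ Adm(v)`. If `v ≡ 0, 1 [MOD 8]`, then `b` kites use up all edges, so that any
`b - 1` blocks of a maximum packing determine the edges of the remaining one, and a kite is
determined by its edges: two maximum packings cannot have exactly `b - 1` common blocks
(`ncard_inter_ne`).

Conversely, for all other pairs `(s, u)` with `s ≤ u ≤ b` two kite systems with `b` blocks have to
be found that share `s` blocks and `u` triangles; they are maximum because they attain the bound.
The constructions glue edge-disjoint pieces, along which the numbers of blocks, of common blocks
and of common triangles add up (`Realizes.union`). A set of edges is *flexible* (`Flexible`) if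
it realizes all these pairs. A *unit* with `n'` blocks (`IsKiteUnit`) realizes at least `(0, 0)`,
`(0, n')` and `(n', n')`. The gluing principle `Flexible.union_unit` says that a flexible set with
`n ≥ 2 n' - 1` blocks stays flexible when a disjoint unit with `n'` blocks is added.

For `4 ≤ v ≤ 23`, `K_v` contains a small flexible core and edge-disjoint wheels, which are units
with two blocks; they have `kiteB v` blocks together. They are given by explicit lists, which are
checked by evaluation (`flexible_of_completeCheck`).

For `v = 8 k + e` with `k ≥ 3` and `e < 8` (`flexible_groups`), the vertices are `e` common points
and `k` groups of eight. The first group together with the common points carries `K_{8 + e}`,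
which is flexible. Every other group together with the common points carries `K_{8 + e}` without
the edges between common points, which contains a unit with `7 + 2 e` blocks, again given by a
list. The edges between different groups are partitioned into units with four blocks. For this,
the complete multipartite graph with `k` groups of size two is decomposed into kites, by a
difference construction over `ZMod m` with `m` odd (`exists_kiteFamily`). Doubling its vertices
turns every kite into four kites (`IsKiteFamily.double`), and doubling them once more turns every
one of these into a unit with four blocks (`isKiteUnit_double`). The numbers of blocks add up to
`kiteB v` by `kiteB_eight_mul_add`.
-/

/-! ### Blocks and kite systems -/

/-- A block with vertices in `V`, encoded as its triangle together with its pendant edge. -/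
abbrev KiteBlock (V : Type*) := Finset V × Sym2 V

/-- The four edges of the kite with triangle `a, b, c` and pendant edge `cd`,
given as the tuple `(a, b, c, d)`. -/
def kiteEdges {V : Type*} (k : V × V × V × V) : List (Sym2 V) :=
  [s(k.1, k.2.1), s(k.1, k.2.2.1), s(k.2.1, k.2.2.1), s(k.2.2.1, k.2.2.2)]

/-- The tuple `(a, b, c, d)` consists of four distinct vertices. -/
def IsKiteTuple {V : Type*} (k : V × V × V × V) : Prop :=
  [k.1, k.2.1, k.2.2.1, k.2.2.2].Nodup

instance {V : Type*} [DecidableEq V] (k : V × V × V × V) : Decidable (IsKiteTuple k) :=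
  inferInstanceAs (Decidable (List.Nodup _))

/-- The block described by a tuple `(a, b, c, d)`. -/
def kiteBlock {V : Type*} [DecidableEq V] (k : V × V × V × V) : KiteBlock V :=
  ({k.1, k.2.1, k.2.2.1}, s(k.2.2.1, k.2.2.2))

/-- The edges of a block: the pairs inside its triangle, and the pendant edge. -/
def KiteBlock.edges {V : Type*} (p : KiteBlock V) : Set (Sym2 V) :=
  {e | ((∀ x ∈ e, x ∈ p.1) ∧ ¬ e.IsDiag) ∨ e = p.2}

/-- A kite system in the edge set `E`: a finite set of pairwise edge-disjoint blocks, all of whose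
edges lie in `E`. -/
structure IsKiteSystem {V : Type*} [DecidableEq V] (E : Set (Sym2 V))
    (P : Finset (KiteBlock V)) : Prop where
  exists_tuple : ∀ p ∈ P, ∃ k, IsKiteTuple k ∧ p = kiteBlock k
  edges_subset : ∀ p ∈ P, p.edges ⊆ E
  eq_of_mem : ∀ p ∈ P, ∀ q ∈ P, ∀ e, e ∈ p.edges → e ∈ q.edges → p = q

/-- There are two kite systems in `E` with `n` blocks each, sharing exactly `s` blocks and
exactly `u` triangles. -/
def Realizes {V : Type*} [DecidableEq V] (E : Set (Sym2 V)) (n s u : ℕ) : Prop :=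
  ∃ P Q : Finset (KiteBlock V), IsKiteSystem E P ∧ IsKiteSystem E Q ∧ P.card = n ∧ Q.card = n ∧
    (P ∩ Q).card = s ∧ (P.image Prod.fst ∩ Q.image Prod.fst).card = u

theorem mem_edges_kiteBlock {V : Type*} [DecidableEq V] {k : V × V × V × V}
    (hk : IsKiteTuple k) (e : Sym2 V) :
    e ∈ (kiteBlock k).edges ↔ e ∈ kiteEdges k := by
  obtain ⟨a, b, c, d⟩ := k
  simp only [IsKiteTuple, List.nodup_cons, List.mem_cons, List.not_mem_nil, or_false, not_or,
    not_false_eq_true, List.nodup_nil, and_true] at hk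
  induction e using Sym2.ind with
  | _ x y =>
    simp only [KiteBlock.edges, kiteBlock, kiteEdges, Set.mem_ofPred_eq, Sym2.mem_iff,
      Sym2.mk_isDiag_iff, Finset.mem_insert, Finset.mem_singleton, List.mem_cons,
      List.not_mem_nil, or_false, Sym2.eq_iff, forall_eq_or_imp, forall_eq]
    grind

theorem card_fst_kiteBlock {V : Type*} [DecidableEq V] {k : V × V × V × V} (hk : IsKiteTuple k) :
    (kiteBlock k).1.card = 3 := by
  obtain ⟨a, b, c, d⟩ := k
  simp only [IsKiteTuple, List.nodup_cons, List.mem_cons, List.not_mem_nil, or_false, not_or,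
    not_false_eq_true, List.nodup_nil, and_true] at hk
  exact Finset.card_eq_three.2 ⟨a, b, c, hk.1.1, hk.1.2.1, hk.2.1.1, rfl⟩

theorem KiteBlock.snd_mem_edges {V : Type*} (p : KiteBlock V) : p.2 ∈ p.edges := Or.inr rfl

/-- Two blocks of edge-disjoint systems with a common triangle would share an edge of it. -/
theorem exists_common_edge {V : Type*} [DecidableEq V] {p q : KiteBlock V} (h : p.1 = q.1)
    (hp : p.1.card = 3) :
    ∃ e, e ∈ p.edges ∧ e ∈ q.edges := by
  obtain ⟨a, b, c, hab, -, -, h3⟩ := Finset.card_eq_three.1 hp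
  refine ⟨s(a, b), Or.inl ⟨?_, by simpa using hab⟩, Or.inl ⟨?_, by simpa using hab⟩⟩
  · simp [h3]
  · simp [← h, h3]

theorem IsKiteSystem.card_fst {V : Type*} [DecidableEq V] {E : Set (Sym2 V)}
    {P : Finset (KiteBlock V)}
    (hP : IsKiteSystem E P) {p : KiteBlock V} (hp : p ∈ P) : p.1.card = 3 := by
  obtain ⟨k, hk, rfl⟩ := hP.exists_tuple p hp
  exact card_fst_kiteBlock hk

theorem IsKiteSystem.mono {V : Type*} [DecidableEq V] {E E' : Set (Sym2 V)}
    {P : Finset (KiteBlock V)}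
    (hP : IsKiteSystem E P) (h : E ⊆ E') : IsKiteSystem E' P :=
  ⟨hP.exists_tuple, fun p hp => (hP.edges_subset p hp).trans h, hP.eq_of_mem⟩

theorem Realizes.mono {V : Type*} [DecidableEq V] {E E' : Set (Sym2 V)} {n s u : ℕ}
    (h : Realizes E n s u) (hE : E ⊆ E') :
    Realizes E' n s u := by
  obtain ⟨P, Q, hP, hQ, h⟩ := h
  exact ⟨P, Q, hP.mono hE, hQ.mono hE, h⟩

theorem IsKiteSystem.ne {V : Type*} [DecidableEq V] {E E' : Set (Sym2 V)}
    {P Q : Finset (KiteBlock V)}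
    (hP : IsKiteSystem E P) (hQ : IsKiteSystem E' Q) (h : Disjoint E E') {p q : KiteBlock V}
    (hp : p ∈ P) (hq : q ∈ Q) {e : Sym2 V} (he : e ∈ p.edges) (he' : e ∈ q.edges) : False :=
  Set.disjoint_left.1 h (hP.edges_subset p hp he) (hQ.edges_subset q hq he')

theorem IsKiteSystem.union {V : Type*} [DecidableEq V] {E E' : Set (Sym2 V)}
    {P Q : Finset (KiteBlock V)}
    (hP : IsKiteSystem E P) (hQ : IsKiteSystem E' Q) (h : Disjoint E E') :
    IsKiteSystem (E ∪ E') (P ∪ Q) where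
  exists_tuple p hp := (Finset.mem_union.1 hp).elim (hP.exists_tuple p) (hQ.exists_tuple p)
  edges_subset p hp := (Finset.mem_union.1 hp).elim
    (fun hp => (hP.edges_subset p hp).trans Set.subset_union_left)
    (fun hp => (hQ.edges_subset p hp).trans Set.subset_union_right)
  eq_of_mem p hp q hq e he he' := by
    rcases Finset.mem_union.1 hp with hp | hp <;> rcases Finset.mem_union.1 hq with hq | hq
    · exact hP.eq_of_mem p hp q hq e he he'
    · exact (hP.ne hQ h hp hq he he').elim
    · exact (hP.ne hQ h hq hp he' he).elim
    · exact hQ.eq_of_mem p hp q hq e he he'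

theorem IsKiteSystem.disjoint {V : Type*} [DecidableEq V] {E E' : Set (Sym2 V)}
    {P Q : Finset (KiteBlock V)}
    (hP : IsKiteSystem E P) (hQ : IsKiteSystem E' Q) (h : Disjoint E E') : Disjoint P Q :=
  Finset.disjoint_left.2 fun p hp hq => hP.ne hQ h hp hq p.snd_mem_edges p.snd_mem_edges

theorem IsKiteSystem.disjoint_fst {V : Type*} [DecidableEq V] {E E' : Set (Sym2 V)}
    {P Q : Finset (KiteBlock V)}
    (hP : IsKiteSystem E P) (hQ : IsKiteSystem E' Q) (h : Disjoint E E') :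
    Disjoint (P.image Prod.fst) (Q.image Prod.fst) := by
  refine Finset.disjoint_left.2 fun T hT hT' => ?_
  obtain ⟨p, hp, rfl⟩ := Finset.mem_image.1 hT
  obtain ⟨q, hq, hpq⟩ := Finset.mem_image.1 hT'
  obtain ⟨e, he, he'⟩ := exists_common_edge hpq.symm (hP.card_fst hp)
  exact hP.ne hQ h hp hq he he'

theorem card_union_inter_union {α : Type*} [DecidableEq α] {A B A' B' : Finset α}
    (h : Disjoint A B) (h₁ : Disjoint A B') (h₂ : Disjoint A' B) :
    ((A ∪ B) ∩ (A' ∪ B')).card = (A ∩ A').card + (B ∩ B').card := by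
  rw [← Finset.card_union_of_disjoint
    (h.mono Finset.inter_subset_left Finset.inter_subset_left :
      Disjoint (A ∩ A') (B ∩ B'))]
  congr 1
  ext x
  have h3 : x ∈ A → x ∉ B' := fun hx => Finset.disjoint_left.1 h₁ hx
  have h4 : x ∈ A' → x ∉ B := fun hx => Finset.disjoint_left.1 h₂ hx
  simp only [Finset.mem_inter, Finset.mem_union]
  tauto

theorem Realizes.union {V : Type*} [DecidableEq V] {E E' : Set (Sym2 V)} {n s u n' s' u' : ℕ}
    (h : Realizes E n s u)
    (h' : Realizes E' n' s' u') (hd : Disjoint E E') :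
    Realizes (E ∪ E') (n + n') (s + s') (u + u') := by
  obtain ⟨P, Q, hP, hQ, rfl, hn, rfl, rfl⟩ := h
  obtain ⟨P', Q', hP', hQ', rfl, hn', rfl, rfl⟩ := h'
  refine ⟨P ∪ P', Q ∪ Q', hP.union hP' hd, hQ.union hQ' hd, ?_, ?_, ?_, ?_⟩
  · exact Finset.card_union_of_disjoint (hP.disjoint hP' hd)
  · rw [Finset.card_union_of_disjoint (hQ.disjoint hQ' hd), hn, hn']
  · exact card_union_inter_union (hP.disjoint hP' hd) (hP.disjoint hQ' hd) (hQ.disjoint hP' hd)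
  · rw [Finset.image_union, Finset.image_union]
    exact card_union_inter_union (hP.disjoint_fst hP' hd) (hP.disjoint_fst hQ' hd)
      (hQ.disjoint_fst hP' hd)

/-- The image of a block under a map of vertices. -/
def KiteBlock.map {V W : Type*} [DecidableEq W] (f : V → W) (p : KiteBlock V) : KiteBlock W :=
    (p.1.image f, p.2.map f)

theorem KiteBlock.map_kiteBlock {V W : Type*} [DecidableEq V] [DecidableEq W] (f : V → W)
    (k : V × V × V × V) :
    (kiteBlock k).map f = kiteBlock (f k.1, f k.2.1, f k.2.2.1, f k.2.2.2) := by
  simp [kiteBlock, KiteBlock.map, Finset.image_insert]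

theorem kiteEdges_map {V W : Type*} (f : V → W) (k : V × V × V × V) :
    kiteEdges (f k.1, f k.2.1, f k.2.2.1, f k.2.2.2) = (kiteEdges k).map (Sym2.map f) := by
  simp [kiteEdges]

theorem mem_of_mem_kiteEdges {V : Type*} {k : V × V × V × V} {S : Set V}
    (h : ∀ e ∈ kiteEdges k, ∀ x ∈ e, x ∈ S) :
    k.1 ∈ S ∧ k.2.1 ∈ S ∧ k.2.2.1 ∈ S ∧ k.2.2.2 ∈ S := by
  simp only [kiteEdges, List.mem_cons, List.not_mem_nil, or_false, forall_eq_or_imp,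
    Sym2.mem_iff, forall_eq] at h
  tauto

theorem IsKiteTuple.map {V W : Type*} {f : V → W} {S : Set V} (hf : Set.InjOn f S)
    {k : V × V × V × V} (hk : IsKiteTuple k) (hS : ∀ e ∈ kiteEdges k, ∀ x ∈ e, x ∈ S) :
    IsKiteTuple (f k.1, f k.2.1, f k.2.2.1, f k.2.2.2) := by
  obtain ⟨h1, h2, h3, h4⟩ := mem_of_mem_kiteEdges hS
  have h : ∀ x ∈ [k.1, k.2.1, k.2.2.1, k.2.2.2], x ∈ S := by simp [h1, h2, h3, h4]
  exact List.Nodup.map_on (f := f) (fun x hx y hy hxy => hf (h x hx) (h y hy) hxy) hk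

theorem Realizes.map {V W : Type*} [DecidableEq V] [DecidableEq W] {E : Set (Sym2 V)} {n s u : ℕ}
    {f : V → W} {S : Set V}
    (hE : ∀ e ∈ E, ∀ x ∈ e, x ∈ S) (hf : Set.InjOn f S) (h : Realizes E n s u) :
    Realizes (Sym2.map f '' E) n s u := by
  obtain ⟨P, Q, hP, hQ, rfl, hn, rfl, rfl⟩ := h
  rcases isEmpty_or_nonempty V with hV | hV
  · have h0 : ∀ P : Finset (KiteBlock V), IsKiteSystem E P → P = ∅ := fun P hP =>
      Finset.eq_empty_of_forall_notMem fun p hp => by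
        obtain ⟨k, -⟩ := hP.exists_tuple p hp
        exact hV.elim k.1
    rw [h0 P hP, h0 Q hQ]
    exact ⟨∅, ∅, by constructor <;> simp, by constructor <;> simp, by simp⟩
  -- a left inverse `g` of `f` on `S` shows that nothing is identified
  set g := Function.invFunOn f S
  have hg : ∀ x ∈ S, g (f x) = x := fun x hx => hf.leftInvOn_invFunOn hx
  have hmem : ∀ P : Finset (KiteBlock V), IsKiteSystem E P → ∀ p ∈ P,
      (∀ x ∈ p.1, x ∈ S) ∧ (∀ x ∈ p.2, x ∈ S) := by
    intro P hP p hp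
    obtain ⟨k, hk, rfl⟩ := hP.exists_tuple p hp
    obtain ⟨h1, h2, h3, h4⟩ := mem_of_mem_kiteEdges (k := k) (S := S) fun e he =>
      hE e (hP.edges_subset _ hp ((mem_edges_kiteBlock hk e).2 he))
    simp only [kiteBlock, Finset.mem_insert, Finset.mem_singleton, Sym2.mem_iff]
    constructor
    · rintro x (rfl | rfl | rfl) <;> assumption
    · rintro x (rfl | rfl) <;> assumption
  have hgT : ∀ T : Finset V, (∀ x ∈ T, x ∈ S) → (T.image f).image g = T := by
    intro T hT
    rw [Finset.image_image, Finset.image_congr (g := id), Finset.image_id]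
    exact fun x hx => hg x (hT x hx)
  have hge : ∀ e : Sym2 V, (∀ x ∈ e, x ∈ S) → (e.map f).map g = e := by
    intro e he
    induction e using Sym2.ind with
    | _ x y => simp [hg x (he x (by simp)), hg y (he y (by simp))]
  have hgp : ∀ P : Finset (KiteBlock V), IsKiteSystem E P → ∀ p ∈ P, (p.map f).map g = p := by
    intro P hP p hp
    obtain ⟨h1, h2⟩ := hmem P hP p hp
    exact Prod.ext (hgT _ h1) (hge _ h2)
  have hinj : ∀ p ∈ P ∪ Q, ∀ q ∈ P ∪ Q, p.map f = q.map f → p = q := by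
    intro p hp q hq hpq
    have h1 : ∀ r ∈ P ∪ Q, (r.map f).map g = r := fun r hr =>
      (Finset.mem_union.1 hr).elim (hgp P hP r) (hgp Q hQ r)
    rw [← h1 p hp, ← h1 q hq, hpq]
  have hinjT : ∀ T ∈ P.image Prod.fst ∪ Q.image Prod.fst, ∀ T' ∈ P.image Prod.fst ∪
      Q.image Prod.fst, T.image f = T'.image f → T = T' := by
    intro T hT T' hT' hTT
    have h1 : ∀ T ∈ P.image Prod.fst ∪ Q.image Prod.fst, (T.image f).image g = T := by
      intro T hT
      rw [← Finset.image_union] at hT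
      obtain ⟨p, hp, rfl⟩ := Finset.mem_image.1 hT
      exact hgT _ ((Finset.mem_union.1 hp).elim (fun h => (hmem P hP p h).1)
        (fun h => (hmem Q hQ p h).1))
    rw [← h1 T hT, ← h1 T' hT', hTT]
  have hsys : ∀ P : Finset (KiteBlock V), IsKiteSystem E P →
      IsKiteSystem (Sym2.map f '' E) (P.image (KiteBlock.map f)) := by
    intro P hP
    have hk : ∀ p ∈ P, ∃ k, IsKiteTuple k ∧ p = kiteBlock k ∧
        IsKiteTuple (f k.1, f k.2.1, f k.2.2.1, f k.2.2.2) := by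
      intro p hp
      obtain ⟨k, hk, rfl⟩ := hP.exists_tuple p hp
      refine ⟨k, hk, rfl, ?_⟩
      exact hk.map hf fun e he =>
        hE e (hP.edges_subset _ hp ((mem_edges_kiteBlock hk e).2 he))
    have hedge : ∀ p ∈ P, (p.map f).edges = Sym2.map f '' p.edges := by
      intro p hp
      obtain ⟨k, hk, rfl, hk'⟩ := hk p hp
      ext e
      rw [KiteBlock.map_kiteBlock, mem_edges_kiteBlock hk', kiteEdges_map, List.mem_map]
      simp only [Set.mem_image, mem_edges_kiteBlock hk]
    refine ⟨?_, ?_, ?_⟩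
    · intro q hq
      obtain ⟨p, hp, rfl⟩ := Finset.mem_image.1 hq
      obtain ⟨k, hk, rfl, hk'⟩ := hk p hp
      exact ⟨_, hk', KiteBlock.map_kiteBlock f k⟩
    · intro q hq
      obtain ⟨p, hp, rfl⟩ := Finset.mem_image.1 hq
      rw [hedge p hp]
      exact Set.image_mono (hP.edges_subset p hp)
    · intro q hq q' hq' e he he'
      obtain ⟨p, hp, rfl⟩ := Finset.mem_image.1 hq
      obtain ⟨p', hp', rfl⟩ := Finset.mem_image.1 hq'
      rw [hedge p hp] at he
      rw [hedge p' hp'] at he'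
      obtain ⟨e₁, he₁, rfl⟩ := he
      obtain ⟨e₂, he₂, h12⟩ := he'
      have : e₂ = e₁ := by
        rw [← hge e₁ (hE _ (hP.edges_subset p hp he₁)), ← h12,
          hge e₂ (hE _ (hP.edges_subset p' hp' he₂))]
      subst this
      rw [hP.eq_of_mem p hp p' hp' _ he₁ he₂]
  have hPi : Set.InjOn (KiteBlock.map f) (P ∪ Q : Finset (KiteBlock V)) := hinj
  refine ⟨P.image (KiteBlock.map f), Q.image (KiteBlock.map f), hsys P hP, hsys Q hQ, ?_, ?_, ?_,
    ?_⟩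
  · exact Finset.card_image_of_injOn (hPi.mono (by simp))
  · rw [← hn]
    exact Finset.card_image_of_injOn (hPi.mono (by simp))
  · rw [← Finset.image_inter_of_injOn P Q (by simpa using hPi)]
    exact Finset.card_image_of_injOn (hPi.mono (by
      intro x hx; simp only [Finset.coe_inter, Set.mem_inter_iff, Finset.mem_coe] at hx
      simp [hx.1]))
  · have hT : Set.InjOn (Finset.image f) (P.image Prod.fst ∪ Q.image Prod.fst :
        Finset (Finset V)) := hinjT
    have him : ∀ P : Finset (KiteBlock V), (P.image (KiteBlock.map f)).image Prod.fst =
        (P.image Prod.fst).image (Finset.image f) := by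
      intro P
      rw [Finset.image_image, Finset.image_image]
      rfl
    rw [him, him, ← Finset.image_inter_of_injOn _ _ (by simpa using hT)]
    exact Finset.card_image_of_injOn (hT.mono (by
      intro x hx; rw [Finset.mem_coe, Finset.mem_inter] at hx
      rw [Finset.mem_coe, Finset.mem_union]; exact Or.inl hx.1))

/-! ### Flexible edge sets and units -/

/-- All pairs `s ≤ u ≤ n` of numbers of common blocks and common triangles are realized in `E`
by kite systems with `n` blocks; in the `tight` case, where the systems use up all edges of `E`,
the impossible value `s = n - 1` is left out. -/
def Flexible {V : Type*} [DecidableEq V] (tight : Bool) (E : Set (Sym2 V)) (n : ℕ) : Prop :=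
  ∀ s u, s ≤ u → u ≤ n → (tight = true → s + 1 ≠ n) → Realizes E n s u

/-- The edge set `E` admits two kite systems with `n` blocks of each of the following kinds:
without a common triangle; with the same triangles but no common block; and identical. -/
structure IsKiteUnit {V : Type*} [DecidableEq V] (E : Set (Sym2 V)) (n : ℕ) : Prop where
  none : Realizes E n 0 0
  triangles : Realizes E n 0 n
  all : Realizes E n n n

theorem IsKiteUnit.map {V W : Type*} [DecidableEq V] [DecidableEq W] {E : Set (Sym2 V)} {n : ℕ}
    {f : V → W} {S : Set V} (h : IsKiteUnit E n) (hE : ∀ e ∈ E, ∀ x ∈ e, x ∈ S)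
    (hf : Set.InjOn f S) : IsKiteUnit (Sym2.map f '' E) n :=
  ⟨h.none.map hE hf, h.triangles.map hE hf, h.all.map hE hf⟩

theorem IsKiteUnit.mono {V : Type*} [DecidableEq V] {E E' : Set (Sym2 V)} {n : ℕ}
    (h : IsKiteUnit E n) (hE : E ⊆ E') : IsKiteUnit E' n :=
  ⟨h.none.mono hE, h.triangles.mono hE, h.all.mono hE⟩

theorem Flexible.map {V W : Type*} [DecidableEq V] [DecidableEq W] {t : Bool} {E : Set (Sym2 V)}
    {n : ℕ} {f : V → W} {S : Set V} (h : Flexible t E n) (hE : ∀ e ∈ E, ∀ x ∈ e, x ∈ S)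
    (hf : Set.InjOn f S) : Flexible t (Sym2.map f '' E) n :=
  fun s u hs hu ht => (h s u hs hu ht).map hE hf

theorem Flexible.mono {V : Type*} [DecidableEq V] {t : Bool} {E E' : Set (Sym2 V)} {n : ℕ}
    (h : Flexible t E n) (hE : E ⊆ E') : Flexible t E' n :=
  fun s u hs hu ht => (h s u hs hu ht).mono hE

/-- Adding a unit keeps an edge set flexible, if the unit is not too large: a target `(s, u)` is
reached from `(s, u)`, `(s, u - n')` or `(s - n', u - n')`. -/
theorem Flexible.union_unit {V : Type*} [DecidableEq V] {t : Bool} {E E' : Set (Sym2 V)}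
    {n n' : ℕ} (h : Flexible t E n) (h' : IsKiteUnit E' n') (hd : Disjoint E E') (hn' : 2 ≤ n')
    (hn : 2 * n' ≤ n + 1) : Flexible t (E ∪ E') (n + n') := by
  intro s u hsu hu ht
  have key : ∀ s₀ u₀, Realizes E' n' s₀ u₀ → s₀ ≤ s → u₀ ≤ u → s - s₀ ≤ u - u₀ → u - u₀ ≤ n →
      (t = true → s - s₀ + 1 ≠ n) → Realizes (E ∪ E') (n + n') s u := by
    intro s₀ u₀ h0 hs hu hsu' hn ht
    have := (h (s - s₀) (u - u₀) hsu' hn ht).union h0 hd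
    rwa [Nat.sub_add_cancel hs, Nat.sub_add_cancel hu] at this
  rcases le_or_gt u n with hun | hun
  · by_cases hs : s + 1 = n
    · exact key n' n' h'.all (by omega) (by omega) (by omega) (by omega) fun _ => by omega
    · exact key 0 0 h'.none (by omega) (by omega) (by omega) (by omega) (by simp [hs])
  · by_cases hs : s ≤ u - n' ∧ s + 1 ≠ n
    · exact key 0 n' h'.triangles (by omega) (by omega) (by omega) (by omega) (by simp [hs.2])
    · refine key n' n' h'.all (by omega) (by omega) (by omega) (by omega) fun h1 h2 => ?_
      have := ht h1
      omega

/-- A finite family of pairwise disjoint units may be added to a flexible edge set. -/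
theorem Flexible.iUnion_unit {V J : Type*} [DecidableEq V] [Fintype J] {t : Bool}
    {E : Set (Sym2 V)} {F : J → Set (Sym2 V)} {n n' : ℕ} (h : Flexible t E n)
    (h' : ∀ j, IsKiteUnit (F j) n') (hd : ∀ j, Disjoint E (F j))
    (hF : ∀ i j e, e ∈ F i → e ∈ F j → i = j) (hn' : 2 ≤ n') (hn : 2 * n' ≤ n + 1) :
    Flexible t (E ∪ ⋃ j, F j) (n + Fintype.card J * n') := by
  classical
  have key : ∀ A : Finset J, Flexible t (E ∪ ⋃ j ∈ A, F j) (n + A.card * n') := by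
    intro A
    induction A using Finset.induction_on with
    | empty => simpa using h
    | insert j A hj ih =>
      rw [Finset.card_insert_of_notMem hj, Nat.add_mul, ← Nat.add_assoc, Nat.one_mul]
      refine (ih.union_unit (h' j) ?_ hn' ?_).mono ?_
      · rw [Set.disjoint_left]
        rintro e (he | he) he'
        · exact Set.disjoint_left.1 (hd j) he he'
        · obtain ⟨i, hi, he⟩ := Set.mem_iUnion₂.1 he
          exact hj (hF i j e he he' ▸ hi)
      · have := Nat.zero_le (A.card * n')
        omega
      · rintro e ((he | he) | he)
        · exact Or.inl he
        · obtain ⟨i, hi, he⟩ := Set.mem_iUnion₂.1 he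
          exact Or.inr (Set.mem_iUnion₂.2 ⟨i, Finset.mem_insert_of_mem hi, he⟩)
        · exact Or.inr (Set.mem_iUnion₂.2 ⟨j, Finset.mem_insert_self _ _, he⟩)
  refine (key Finset.univ).mono ?_
  simp

/-! ### Checking explicit kite systems -/

/-- The two tuples have the same triangle. -/
def sameTriangle (p q : ℕ × ℕ × ℕ × ℕ) : Bool :=
  (p.1 == q.1 || p.1 == q.2.1 || p.1 == q.2.2.1) &&
    (p.2.1 == q.1 || p.2.1 == q.2.1 || p.2.1 == q.2.2.1) &&
    (p.2.2.1 == q.1 || p.2.2.1 == q.2.1 || p.2.2.1 == q.2.2.1)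

/-- The two tuples describe the same block. -/
def sameKite (p q : ℕ × ℕ × ℕ × ℕ) : Bool :=
  p.2.2.2 == q.2.2.2 && p.2.2.1 == q.2.2.1 && sameTriangle p q

/-- A code for the edge `ab`, independent of the order of its ends. Different codes belong to
different edges; the converse holds for vertices below `32` and is not needed. -/
def edgeCode (a b : ℕ) : ℕ := if a < b then 32 * a + b else 32 * b + a

/-- The codes of the four edges of a kite. -/
def kiteCodes (k : ℕ × ℕ × ℕ × ℕ) : List ℕ :=
  [edgeCode k.1 k.2.1, edgeCode k.1 k.2.2.1, edgeCode k.2.1 k.2.2.1, edgeCode k.2.2.1 k.2.2.2]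

/-- The edges of the complete graph on `{0, …, v - 1}` that do not lie inside `{0, …, w - 1}`. -/
def edgesOutside (v w : ℕ) : Set (Sym2 ℕ) :=
  {e | ¬ e.IsDiag ∧ (∀ x ∈ e, x < v) ∧ ∃ x ∈ e, w ≤ x}

/-- The tuple describes a kite all of whose edges lie in `edgesOutside v w`. -/
def kiteCheck (v w : ℕ) (k : ℕ × ℕ × ℕ × ℕ) : Bool :=
  decide (IsKiteTuple k) && (k.1 < v && k.2.1 < v && k.2.2.1 < v && k.2.2.2 < v) &&
    ((w ≤ k.1 || w ≤ k.2.1) && (w ≤ k.1 || w ≤ k.2.2.1) && (w ≤ k.2.1 || w ≤ k.2.2.1) &&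
      (w ≤ k.2.2.1 || w ≤ k.2.2.2))

/-- The list describes a kite system with `n` blocks in `edgesOutside v w`. -/
def packCheck (v w n : ℕ) (P : List (ℕ × ℕ × ℕ × ℕ)) : Bool :=
  P.length == n && P.all (kiteCheck v w) && decide (P.flatMap kiteCodes).Nodup

/-- The numbers of common blocks and of common triangles of two kite systems. -/
def commonCounts (P Q : List (ℕ × ℕ × ℕ × ℕ)) : ℕ × ℕ :=
  ((P.filter fun p => Q.any (sameKite p)).length,
    (P.filter fun p => Q.any (sameTriangle p)).length)

/-- All values of `commonCounts` on the given list of kite systems. -/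
def allCounts (L : List (List (ℕ × ℕ × ℕ × ℕ))) : List (ℕ × ℕ) :=
  L.flatMap fun P => L.map fun Q => commonCounts P Q

/-- The edges of the listed kite systems. -/
def listEdges (L : List (List (ℕ × ℕ × ℕ × ℕ))) : Set (Sym2 ℕ) :=
  {e | ∃ P ∈ L, ∃ k ∈ P, e ∈ kiteEdges k}

theorem sameTriangle_iff {p q : ℕ × ℕ × ℕ × ℕ} (hp : IsKiteTuple p) (hq : IsKiteTuple q) :
    sameTriangle p q = true ↔ (kiteBlock p).1 = (kiteBlock q).1 := by
  have h1 : sameTriangle p q = true ↔ (kiteBlock p).1 ⊆ (kiteBlock q).1 := by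
    simp only [sameTriangle, kiteBlock, Bool.and_eq_true, Bool.or_eq_true, beq_iff_eq,
      Finset.insert_subset_iff, Finset.singleton_subset_iff, Finset.mem_insert,
      Finset.mem_singleton]
    tauto
  rw [h1]
  exact ⟨fun h => Finset.eq_of_subset_of_card_le h
    (by rw [card_fst_kiteBlock hp, card_fst_kiteBlock hq]), fun h => h.subset⟩

theorem sameKite_iff {p q : ℕ × ℕ × ℕ × ℕ} (hp : IsKiteTuple p) (hq : IsKiteTuple q) :
    sameKite p q = true ↔ kiteBlock p = kiteBlock q := by
  rw [sameKite, Bool.and_eq_true, Bool.and_eq_true, sameTriangle_iff hp hq, Prod.ext_iff]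
  simp only [beq_iff_eq]
  constructor
  · rintro ⟨⟨h1, h2⟩, h3⟩
    exact ⟨h3, by simp [kiteBlock, h1, h2]⟩
  · rintro ⟨h1, h2⟩
    have h3 : p.2.2.2 ∉ (kiteBlock q).1 := by
      rw [← h1]
      simp only [IsKiteTuple, List.nodup_cons, List.mem_cons, List.not_mem_nil, or_false, not_or,
        not_false_eq_true, List.nodup_nil, and_true] at hp
      simp only [kiteBlock, Finset.mem_insert, Finset.mem_singleton]
      grind
    simp only [kiteBlock, Finset.mem_insert, Finset.mem_singleton, not_or] at h3
    rcases Sym2.eq_iff.1 h2 with ⟨h4, h5⟩ | ⟨-, h5⟩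
    · exact ⟨⟨h5, h4⟩, h1⟩
    · exact absurd h5 h3.2.2

theorem edgeCode_mem_kiteCodes {k : ℕ × ℕ × ℕ × ℕ} {a b : ℕ} (h : s(a, b) ∈ kiteEdges k) :
    edgeCode a b ∈ kiteCodes k := by
  have hc : ∀ a b, edgeCode a b = edgeCode b a := by
    intro a b
    unfold edgeCode
    split_ifs <;> omega
  simp only [kiteEdges, List.mem_cons, List.not_mem_nil, or_false, Sym2.eq_iff] at h
  simp only [kiteCodes, List.mem_cons, List.not_mem_nil, or_false]
  rcases h with (⟨rfl, rfl⟩ | ⟨rfl, rfl⟩) | (⟨rfl, rfl⟩ | ⟨rfl, rfl⟩) |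
    (⟨rfl, rfl⟩ | ⟨rfl, rfl⟩) | (⟨rfl, rfl⟩ | ⟨rfl, rfl⟩)
  · exact Or.inl rfl
  · exact Or.inl (hc _ _)
  · exact Or.inr (Or.inl rfl)
  · exact Or.inr (Or.inl (hc _ _))
  · exact Or.inr (Or.inr (Or.inl rfl))
  · exact Or.inr (Or.inr (Or.inl (hc _ _)))
  · exact Or.inr (Or.inr (Or.inr rfl))
  · exact Or.inr (Or.inr (Or.inr (hc _ _)))

theorem kiteEdges_subset_edgesOutside {v w : ℕ} {k : ℕ × ℕ × ℕ × ℕ}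
    (h : kiteCheck v w k = true) : IsKiteTuple k ∧ ∀ e ∈ kiteEdges k, e ∈ edgesOutside v w := by
  obtain ⟨a, b, c, d⟩ := k
  simp only [kiteCheck, Bool.and_eq_true, decide_eq_true_eq, Bool.or_eq_true] at h
  obtain ⟨⟨hk, h1⟩, h2⟩ := h
  refine ⟨hk, ?_⟩
  simp only [IsKiteTuple, List.nodup_cons, List.mem_cons, List.not_mem_nil, or_false, not_or,
    not_false_eq_true, List.nodup_nil, and_true] at hk
  simp only [kiteEdges, List.mem_cons, List.not_mem_nil, or_false, edgesOutside,
    Set.mem_ofPred_eq, forall_eq_or_imp, forall_eq, Sym2.mk_isDiag_iff, Sym2.mem_iff,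
    exists_eq_or_imp, exists_eq_left]
  tauto

theorem card_inter_toFinset_map {α β : Type*} [DecidableEq β] {f : α → β} {P Q : List α}
    {r : α → α → Bool} (hP : (P.map f).Nodup)
    (hr : ∀ p ∈ P, ∀ q ∈ Q, (r p q = true ↔ f p = f q)) :
    ((P.map f).toFinset ∩ (Q.map f).toFinset).card = (P.filter fun p => Q.any (r p)).length := by
  have h : (P.map f).toFinset ∩ (Q.map f).toFinset =
      ((P.filter fun p => Q.any (r p)).map f).toFinset := by
    ext x
    simp only [Finset.mem_inter, List.mem_toFinset, List.mem_map, List.mem_filter, List.any_eq_true]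
    constructor
    · rintro ⟨⟨p, hp, rfl⟩, q, hq, hqp⟩
      exact ⟨p, ⟨hp, q, hq, (hr p hp q hq).2 hqp.symm⟩, rfl⟩
    · rintro ⟨p, ⟨hp, q, hq, hpq⟩, rfl⟩
      exact ⟨⟨p, hp, rfl⟩, q, hq, ((hr p hp q hq).1 hpq).symm⟩
  rw [h, List.toFinset_card_of_nodup, List.length_map]
  exact hP.sublist (List.filter_sublist.map f)

theorem packCheck_sound {v w n : ℕ} {P : List (ℕ × ℕ × ℕ × ℕ)} (h : packCheck v w n P = true) :
    P.length = n ∧ (∀ k ∈ P, kiteCheck v w k = true) ∧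
      (∀ k ∈ P, ∀ l ∈ P, ∀ e, e ∈ kiteEdges k → e ∈ kiteEdges l → k = l) ∧ P.Nodup := by
  simp only [packCheck, Bool.and_eq_true, beq_iff_eq, List.all_eq_true, decide_eq_true_eq] at h
  obtain ⟨⟨hn, hk⟩, hc⟩ := h
  have hpw := (List.nodup_flatMap.1 hc).2
  refine ⟨hn, hk, ?_, ?_⟩
  · intro k hk l hl e he he'
    by_contra hne
    have hsymm : Std.Symm (Function.onFun List.Disjoint kiteCodes) :=
      ⟨fun _ _ h => List.Disjoint.symm h⟩
    have := hpw.forall hk hl hne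
    induction e using Sym2.ind with
    | _ a b => exact this (edgeCode_mem_kiteCodes he) (edgeCode_mem_kiteCodes he')
  · refine hpw.imp fun {k l} h => ?_
    rintro rfl
    exact h (List.mem_cons_self) (List.mem_cons_self)

theorem realizes_of_mem_allCounts {v w n : ℕ} {L : List (List (ℕ × ℕ × ℕ × ℕ))}
    (hL : L.all (packCheck v w n) = true) {s u : ℕ} (h : (s, u) ∈ allCounts L) :
    Realizes (listEdges L) n s u := by
  rw [List.all_eq_true] at hL
  simp only [allCounts, List.mem_flatMap, List.mem_map] at h
  obtain ⟨P, hP, Q, hQ, hPQ⟩ := h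
  have htup : ∀ P ∈ L, ∀ k ∈ P, IsKiteTuple k := fun P hP k hk =>
    (kiteEdges_subset_edgesOutside ((packCheck_sound (hL P hP)).2.1 k hk)).1
  have hinj : ∀ P ∈ L, ∀ k ∈ P, ∀ l ∈ P, (kiteBlock k).1 = (kiteBlock l).1 → k = l := by
    intro P hP k hk l hl hkl
    obtain ⟨e, he, he'⟩ := exists_common_edge hkl (card_fst_kiteBlock (htup P hP k hk))
    rw [mem_edges_kiteBlock (htup P hP k hk)] at he
    rw [mem_edges_kiteBlock (htup P hP l hl)] at he'
    exact (packCheck_sound (hL P hP)).2.2.1 k hk l hl e he he'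
  have hnd : ∀ P ∈ L, (P.map kiteBlock).Nodup := fun P hP =>
    List.Nodup.map_on (fun k hk l hl hkl => hinj P hP k hk l hl (congrArg Prod.fst hkl))
      (packCheck_sound (hL P hP)).2.2.2
  have hnd' : ∀ P ∈ L, (P.map fun k => (kiteBlock k).1).Nodup := fun P hP =>
    List.Nodup.map_on (hinj P hP) (packCheck_sound (hL P hP)).2.2.2
  have hcard : ∀ P ∈ L, (P.map kiteBlock).toFinset.card = n := fun P hP => by
    rw [List.toFinset_card_of_nodup (hnd P hP), List.length_map, (packCheck_sound (hL P hP)).1]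
  have hsys : ∀ P ∈ L, IsKiteSystem (listEdges L) (P.map kiteBlock).toFinset := by
    intro P hP
    refine ⟨?_, ?_, ?_⟩
    · intro p hp
      obtain ⟨k, hk, rfl⟩ := List.mem_map.1 (List.mem_toFinset.1 hp)
      exact ⟨k, htup P hP k hk, rfl⟩
    · intro p hp e he
      obtain ⟨k, hk, rfl⟩ := List.mem_map.1 (List.mem_toFinset.1 hp)
      exact ⟨P, hP, k, hk, (mem_edges_kiteBlock (htup P hP k hk) e).1 he⟩
    · intro p hp q hq e he he'
      obtain ⟨k, hk, rfl⟩ := List.mem_map.1 (List.mem_toFinset.1 hp)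
      obtain ⟨l, hl, rfl⟩ := List.mem_map.1 (List.mem_toFinset.1 hq)
      rw [(packCheck_sound (hL P hP)).2.2.1 k hk l hl e
        ((mem_edges_kiteBlock (htup P hP k hk) e).1 he)
        ((mem_edges_kiteBlock (htup P hP l hl) e).1 he')]
  simp only [commonCounts, Prod.mk.injEq] at hPQ
  refine ⟨_, _, hsys P hP, hsys Q hQ, hcard P hP, hcard Q hQ, ?_, ?_⟩
  · rw [card_inter_toFinset_map (r := sameKite) (hnd P hP) fun p hp q hq =>
      sameKite_iff (htup P hP p hp) (htup Q hQ q hq)]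
    exact hPQ.1
  · have him : ∀ P : List (ℕ × ℕ × ℕ × ℕ), (P.map kiteBlock).toFinset.image Prod.fst =
        (P.map fun k => (kiteBlock k).1).toFinset := by
      intro P
      ext T
      simp only [Finset.mem_image, List.mem_toFinset, List.mem_map, exists_exists_and_eq_and]
    rw [him, him, card_inter_toFinset_map (r := sameTriangle) (hnd' P hP) fun p hp q hq =>
      sameTriangle_iff (htup P hP p hp) (htup Q hQ q hq)]
    exact hPQ.2

theorem listEdges_subset {v w n : ℕ} {L : List (List (ℕ × ℕ × ℕ × ℕ))}
    (hL : L.all (packCheck v w n) = true) : listEdges L ⊆ edgesOutside v w := by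
  rintro e ⟨P, hP, k, hk, he⟩
  exact (kiteEdges_subset_edgesOutside
    ((packCheck_sound (List.all_eq_true.1 hL P hP)).2.1 k hk)).2 e he

/-- The list of kite systems shows that its edge set is a unit with `n` blocks. -/
def unitCheck (v w n : ℕ) (L : List (List (ℕ × ℕ × ℕ × ℕ))) : Bool :=
  L.all (packCheck v w n) && decide ((0, 0) ∈ allCounts L) && decide ((0, n) ∈ allCounts L) &&
    decide ((n, n) ∈ allCounts L)

theorem isKiteUnit_of_unitCheck {v w n : ℕ} {L : List (List (ℕ × ℕ × ℕ × ℕ))}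
    (h : unitCheck v w n L = true) :
    IsKiteUnit (listEdges L) n ∧ listEdges L ⊆ edgesOutside v w := by
  simp only [unitCheck, Bool.and_eq_true, decide_eq_true_eq] at h
  obtain ⟨⟨⟨h, h1⟩, h2⟩, h3⟩ := h
  exact ⟨⟨realizes_of_mem_allCounts h h1, realizes_of_mem_allCounts h h2,
    realizes_of_mem_allCounts h h3⟩, listEdges_subset h⟩

/-- The list of kite systems shows that its edge set is flexible. -/
def flexCheck (t : Bool) (v n : ℕ) (L : List (List (ℕ × ℕ × ℕ × ℕ))) : Bool :=
  L.all (packCheck v 0 n) && (List.range (n + 1)).all fun u => (List.range (u + 1)).all fun s =>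
    (t && s + 1 == n) || decide ((s, u) ∈ allCounts L)

theorem flexible_of_flexCheck {t : Bool} {v n : ℕ} {L : List (List (ℕ × ℕ × ℕ × ℕ))}
    (h : flexCheck t v n L = true) :
    Flexible t (listEdges L) n ∧ listEdges L ⊆ edgesOutside v 0 := by
  simp only [flexCheck, Bool.and_eq_true] at h
  refine ⟨fun s u hs hu ht => realizes_of_mem_allCounts h.1 ?_, listEdges_subset h.1⟩
  have h2 := List.all_eq_true.1 (List.all_eq_true.1 h.2 u (by simp; omega)) s (by simp; omega)
  simp only [Bool.or_eq_true, Bool.and_eq_true, beq_iff_eq, decide_eq_true_eq] at h2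
  exact h2.resolve_left fun h3 => ht h3.1 h3.2

/-- The codes of all edges of the listed kite systems. -/
def listCodes (L : List (List (ℕ × ℕ × ℕ × ℕ))) : List ℕ :=
  (L.flatMap fun P => P.flatMap kiteCodes).dedup

/-- Starting from a flexible set with `n` blocks whose edges have codes in `used`, the listed units
can be added one after the other, to give `m` blocks in the end. -/
def extendCheck (v m : ℕ) : ℕ → List ℕ → List (List (List (ℕ × ℕ × ℕ × ℕ))) → Bool
  | n, _, [] => n == m
  | n, used, L :: Ls =>
    unitCheck v 0 (L.headD []).length L && decide (2 ≤ (L.headD []).length) &&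
      decide (2 * (L.headD []).length ≤ n + 1) &&
      (listCodes L).all (fun c => decide (c ∉ used)) &&
      extendCheck v m (n + (L.headD []).length) (listCodes L ++ used) Ls

theorem edgeCode_mem_listCodes {L : List (List (ℕ × ℕ × ℕ × ℕ))} {a b : ℕ}
    (h : s(a, b) ∈ listEdges L) : edgeCode a b ∈ listCodes L := by
  obtain ⟨P, hP, k, hk, he⟩ := h
  rw [listCodes, List.mem_dedup, List.mem_flatMap]
  exact ⟨P, hP, List.mem_flatMap.2 ⟨k, hk, edgeCode_mem_kiteCodes he⟩⟩

/-- The check is sound: the codes in `used` keep track of the edges of `E`, and each further unit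
has none of them. -/
theorem flexible_of_extendCheck {t : Bool} {v m : ℕ} :
    ∀ (Ls : List (List (List (ℕ × ℕ × ℕ × ℕ)))) (n : ℕ) (used : List ℕ) (E : Set (Sym2 ℕ)),
      Flexible t E n → E ⊆ edgesOutside v 0 → (∀ a b, s(a, b) ∈ E → edgeCode a b ∈ used) →
      extendCheck v m n used Ls = true → Flexible t (edgesOutside v 0) m
  | [], n, used, E, hE, hEv, _, h => by
    simp only [extendCheck, beq_iff_eq] at h
    exact h ▸ hE.mono hEv
  | L :: Ls, n, used, E, hE, hEv, hused, h => by
    simp only [extendCheck, Bool.and_eq_true, decide_eq_true_eq, List.all_eq_true] at h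
    obtain ⟨⟨⟨⟨h1, h2⟩, h3⟩, h4⟩, h5⟩ := h
    obtain ⟨hu, huv⟩ := isKiteUnit_of_unitCheck h1
    refine flexible_of_extendCheck Ls _ _ (E ∪ listEdges L)
      (hE.union_unit hu ?_ h2 h3) (Set.union_subset hEv huv) ?_ h5
    · rw [Set.disjoint_left]
      intro e he he'
      induction e using Sym2.ind with
      | _ a b => exact h4 _ (edgeCode_mem_listCodes he') (hused a b he)
    · rintro a b (h | h)
      · exact List.mem_append_right _ (hused a b h)
      · exact List.mem_append_left _ (edgeCode_mem_listCodes h)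

/-- The full certificate for the complete graph on `{0, …, v - 1}`: a flexible core `C`, given by
kite systems with `n` blocks, and a list of units. -/
def completeCheck (t : Bool) (v n : ℕ) (C : List (List (ℕ × ℕ × ℕ × ℕ)))
    (Ls : List (List (List (ℕ × ℕ × ℕ × ℕ)))) : Bool :=
  flexCheck t v n C && extendCheck v (kiteB v) n (listCodes C) Ls

theorem flexible_of_completeCheck {t : Bool} {v n : ℕ} {C : List (List (ℕ × ℕ × ℕ × ℕ))}
    {Ls : List (List (List (ℕ × ℕ × ℕ × ℕ)))} (h : completeCheck t v n C Ls = true) :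
    Flexible t (edgesOutside v 0) (kiteB v) := by
  rw [completeCheck, Bool.and_eq_true] at h
  obtain ⟨h1, h2⟩ := flexible_of_flexCheck h.1
  exact flexible_of_extendCheck Ls n _ _ h1 h2 (fun a b hab => edgeCode_mem_listCodes hab) h.2

/-- Three kite systems that partition the wheel with hub `h` and rim `a, b, c, d`. The first two
have the same triangles and no common block, the third shares no triangle with them: the wheel is
a unit with two blocks. -/
def wheel (k : ℕ × ℕ × ℕ × ℕ × ℕ) : List (List (ℕ × ℕ × ℕ × ℕ)) :=
  let (h, a, b, c, d) := k
  [[(h, a, b, c), (h, c, d, a)], [(h, b, a, d), (h, d, c, b)], [(h, c, b, a), (h, a, d, c)]]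

/-- Adjoin wheels to three kite systems, keeping the three systems apart. -/
def addWheels (Ws : List (ℕ × ℕ × ℕ × ℕ × ℕ)) (L : List (List (ℕ × ℕ × ℕ × ℕ))) :
    List (List (ℕ × ℕ × ℕ × ℕ)) :=
  Ws.foldl (fun L k => List.zipWith (· ++ ·) L (wheel k)) L

/-! ### Complete graphs on at most 23 vertices -/

theorem flexible_complete_4 : Flexible false (edgesOutside 4 0) (kiteB 4) :=
  flexible_of_completeCheck (n := 1)
    (C := [[(2,3,1,0)],
     [(0,2,1,3)],
     [(1,3,2,0)]])
    (Ls := [])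
    (by decide +kernel)

theorem flexible_complete_5 : Flexible false (edgesOutside 5 0) (kiteB 5) :=
  flexible_of_completeCheck (n := 2)
    (C := [[(0,3,4,2), (2,3,1,4)],
     [(1,4,0,3), (2,4,3,1)],
     [(1,4,0,3), (1,3,2,0)],
     [(0,4,1,2), (2,4,3,1)],
     [(0,4,1,3), (3,4,2,0)]])
    (Ls := [])
    (by decide +kernel)

theorem flexible_complete_6 : Flexible false (edgesOutside 6 0) (kiteB 6) :=
  flexible_of_completeCheck (n := 3)
    (C := [[(0,3,1,2), (0,4,2,3), (1,4,5,2)],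
     [(0,2,4,1), (3,5,0,1), (1,5,2,3)],
     [(0,3,1,2), (0,2,5,1), (2,3,4,0)],
     [(0,1,3,5), (1,4,5,2), (3,4,2,1)],
     [(0,3,1,2), (1,4,5,2), (3,4,2,0)],
     [(0,3,1,2), (1,4,5,3), (3,4,2,0)]])
    (Ls := [])
    (by decide +kernel)

theorem flexible_complete_7 : Flexible false (edgesOutside 7 0) (kiteB 7) :=
  flexible_of_completeCheck (n := 5)
    (C := [[(0,2,1,4), (0,6,3,2), (0,4,5,2), (3,5,1,6), (2,4,6,5)],
     [(1,2,0,4), (1,3,6,0), (1,4,5,6), (2,5,3,0), (2,6,4,3)],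
     [(2,5,0,1), (0,6,3,1), (1,4,2,6), (1,5,6,4), (3,5,4,0)],
     [(1,2,0,4), (0,6,3,1), (1,6,5,0), (2,3,5,4), (2,6,4,3)],
     [(1,2,0,4), (0,6,3,1), (4,5,1,6), (2,3,5,0), (2,4,6,5)],
     [(1,2,0,4), (0,6,3,1), (4,5,1,6), (2,4,3,5), (2,5,6,4)],
     [(1,2,0,4), (0,6,3,1), (1,6,5,4), (2,3,5,0), (2,6,4,1)],
     [(1,2,0,4), (0,6,3,1), (1,6,5,4), (2,3,5,0), (2,6,4,3)],
     [(0,2,1,4), (3,6,0,4), (1,6,5,0), (2,5,3,4), (2,6,4,5)],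
     [(1,2,0,4), (0,6,3,1), (1,4,5,6), (2,3,5,0), (2,6,4,3)]])
    (Ls := [])
    (by decide +kernel)

theorem flexible_complete_8 : Flexible true (edgesOutside 8 0) (kiteB 8) :=
  flexible_of_completeCheck (n := 7)
    (C := [[(0,3,7,4), (4,5,0,1), (2,7,1,4), (1,6,3,4), (2,3,5,1), (4,6,2,0), (5,7,6,0)],
     [(0,6,1,4), (0,2,4,5), (0,3,7,1), (1,2,3,4), (2,7,5,0), (3,6,5,1), (4,7,6,2)],
     [(1,6,0,7), (0,2,5,6), (0,3,4,6), (1,3,2,4), (4,5,1,7), (2,7,6,3), (3,5,7,4)],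
     [(0,6,1,4), (0,3,7,4), (0,4,5,2), (1,3,2,0), (1,7,5,3), (6,7,2,4), (3,4,6,5)],
     [(0,6,1,4), (0,2,4,6), (0,3,7,4), (1,2,3,6), (1,7,5,0), (6,7,2,5), (3,4,5,6)],
     [(0,6,1,4), (0,2,4,5), (3,5,0,7), (1,5,2,3), (1,3,7,5), (2,6,7,4), (3,4,6,5)],
     [(0,6,1,4), (0,2,4,5), (3,7,0,5), (1,2,3,5), (1,5,7,4), (6,7,2,5), (3,4,6,5)],
     [(0,6,1,4), (3,7,0,2), (0,5,4,2), (1,3,2,5), (1,7,5,3), (2,6,7,4), (3,4,6,5)],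
     [(0,6,1,4), (0,7,3,5), (4,5,0,2), (1,3,2,5), (1,7,5,6), (2,6,7,4), (3,6,4,2)],
     [(0,6,1,4), (0,2,4,5), (3,7,0,5), (1,3,2,5), (1,7,5,3), (2,6,7,4), (3,4,6,5)],
     [(0,6,1,4), (0,2,4,5), (3,5,0,7), (1,2,3,7), (1,7,5,2), (2,6,7,4), (3,4,6,5)],
     [(1,6,0,7), (0,2,4,7), (0,3,5,4), (1,5,2,6), (3,7,1,4), (4,6,3,2), (5,6,7,2)],
     [(0,6,1,4), (2,7,0,4), (0,3,5,1), (3,7,1,2), (4,5,2,3), (3,4,6,2), (5,6,7,4)],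
     [(1,6,0,7), (0,2,4,7), (1,2,5,0), (3,7,1,4), (2,3,6,4), (4,5,3,0), (5,6,7,2)],
     [(1,6,0,7), (0,2,4,7), (0,3,5,4), (1,2,3,7), (1,7,5,2), (2,7,6,5), (3,6,4,1)],
     [(0,6,1,4), (0,2,4,6), (1,5,2,7), (1,3,7,0), (2,6,3,0), (3,4,5,0), (5,6,7,4)],
     [(1,6,0,7), (0,2,4,7), (1,2,5,0), (3,7,1,4), (3,6,2,7), (4,5,3,0), (5,7,6,4)]])
    (Ls := [])
    (by decide +kernel)

theorem flexible_complete_9 : Flexible true (edgesOutside 9 0) (kiteB 9) :=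
  flexible_of_completeCheck (n := 7)
    (C := [[(4,6,0,2), (1,2,6,7), (1,8,3,0), (3,7,2,5), (2,8,4,1), (3,5,6,8), (5,7,4,3)],
     [(0,2,4,8), (0,6,3,5), (1,8,3,4), (1,4,6,7), (3,7,2,1), (6,8,2,5), (4,7,5,6)],
     [(4,6,0,3), (2,6,1,4), (1,8,3,4), (3,5,2,7), (4,8,2,0), (3,7,6,8), (4,7,5,6)],
     [(0,3,2,8), (0,4,6,7), (1,4,2,6), (6,8,1,3), (2,7,5,4), (3,8,4,7), (5,6,3,7)],
     [(2,3,0,4), (1,2,6,8), (1,8,3,4), (2,8,4,1), (2,7,5,4), (5,6,3,7), (4,7,6,0)],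
     [(0,3,2,5), (0,4,6,7), (2,6,1,4), (1,8,3,4), (4,8,2,7), (3,5,6,8), (4,5,7,3)],
     [(0,4,6,8), (2,6,1,4), (1,8,3,4), (2,7,3,0), (4,8,2,0), (3,6,5,2), (4,5,7,6)],
     [(4,6,0,2), (1,2,6,8), (1,8,3,0), (2,7,3,4), (2,8,4,1), (3,6,5,2), (4,5,7,6)],
     [(4,6,0,2), (1,2,6,8), (1,8,3,4), (2,7,3,0), (2,8,4,1), (3,6,5,2), (4,5,7,6)],
     [(4,6,0,2), (1,2,6,8), (1,8,3,4), (2,5,3,0), (2,8,4,1), (3,7,6,5), (4,5,7,2)],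
     [(2,6,0,4), (1,4,2,8), (1,8,3,4), (2,7,3,0), (3,6,5,2), (4,5,7,6), (4,8,6,1)],
     [(0,3,2,7), (0,4,6,7), (2,6,1,4), (1,8,3,4), (2,4,8,6), (3,6,5,2), (4,5,7,3)],
     [(0,2,3,5), (0,4,6,8), (1,6,2,5), (1,8,3,4), (2,8,4,1), (3,7,6,5), (4,5,7,2)],
     [(2,6,0,4), (1,8,3,4), (4,6,1,2), (2,7,3,0), (2,4,8,6), (3,6,5,2), (4,5,7,6)],
     [(0,2,3,7), (0,4,6,8), (2,6,1,4), (1,8,3,4), (4,8,2,7), (3,6,5,2), (4,5,7,6)]])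
    (Ls := [(0,1,5,8,7)].map wheel)
    (by decide +kernel)

theorem flexible_complete_10 : Flexible false (edgesOutside 10 0) (kiteB 10) :=
  flexible_of_completeCheck (n := 5)
    (C := [[(1,8,2,9), (1,4,5,0), (4,6,3,8), (3,5,9,1), (4,9,8,0)],
     [(3,5,1,9), (4,8,1,2), (2,9,8,0), (4,6,3,8), (4,5,9,3)],
     [(2,8,1,9), (3,5,1,4), (3,6,4,8), (3,9,8,0), (4,5,9,2)],
     [(2,8,1,9), (1,4,5,0), (4,6,3,1), (5,9,3,8), (4,8,9,2)],
     [(1,9,2,8), (1,8,3,4), (1,4,5,0), (5,9,3,6), (4,9,8,0)],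
     [(2,9,1,8), (1,4,5,0), (4,6,3,8), (5,9,3,1), (4,9,8,0)],
     [(1,8,2,9), (1,3,9,5), (1,4,5,0), (4,6,3,8), (4,9,8,0)],
     [(1,2,8,0), (4,5,1,9), (4,6,3,1), (5,9,3,8), (4,8,9,2)],
     [(2,8,1,9), (1,4,5,0), (4,6,3,1), (5,9,3,8), (4,9,8,0)]])
    (Ls := [(0,2,3,7,4), (5,2,6,8,7), (6,0,1,7,9)].map wheel)
    (by decide +kernel)

theorem flexible_complete_11 : Flexible false (edgesOutside 11 0) (kiteB 11) :=
  flexible_of_completeCheck (n := 3)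
    (C := [[(1,5,4,9), (5,8,2,9), (6,9,8,1)],
     [(1,5,8,10), (4,5,2,8), (6,8,9,4)],
     [(4,5,1,8), (2,4,9,6), (2,5,8,10)],
     [(4,5,1,8), (2,5,8,10), (6,8,9,4)],
     [(1,5,4,9), (2,5,8,10), (6,9,8,1)]])
    (Ls := [(0,5,7,10,9), (1,2,3,9,7), (3,4,6,5,10), (6,0,1,10,2), (8,0,3,7,4)].map wheel)
    (by decide +kernel)

theorem flexible_complete_12 : Flexible false (edgesOutside 12 0) (kiteB 12) :=
  flexible_of_completeCheck (n := 6)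
    (C := [[(1,10,2,6), (3,9,7,2), (3,10,8,1), (5,10,4,9), (4,7,8,6), (9,10,11,8)],
     [(8,11,1,10), (10,11,2,1), (3,8,7,2), (3,9,10,5), (4,7,9,11), (8,10,4,5)],
     [(1,11,2,6), (1,8,10,2), (3,7,8,6), (3,9,10,11), (5,10,4,8), (4,9,7,2)],
     [(1,10,2,6), (1,8,11,9), (3,7,8,6), (3,9,10,11), (4,5,10,8), (4,9,7,2)],
     [(1,10,2,7), (1,11,8,6), (3,7,8,10), (3,9,10,11), (5,10,4,8), (4,7,9,11)],
     [(1,10,2,6), (1,8,11,9), (3,7,8,6), (3,9,10,11), (7,9,4,5), (4,8,10,5)],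
     [(1,10,2,6), (1,11,8,10), (3,7,8,6), (3,9,10,11), (5,10,4,8), (4,9,7,2)],
     [(1,10,2,6), (1,8,11,9), (3,8,7,2), (3,9,10,11), (7,9,4,5), (4,8,10,5)],
     [(1,10,2,6), (1,8,11,9), (3,7,8,4), (3,9,10,8), (4,5,10,11), (4,9,7,2)],
     [(1,10,2,6), (1,11,8,6), (3,10,8,7), (5,10,4,8), (4,9,7,2), (9,10,11,2)],
     [(1,11,2,6), (1,8,10,2), (3,7,8,6), (5,10,4,8), (4,9,7,2), (9,10,11,8)]])
    (Ls := [(0,1,3,2,4), (0,6,10,7,11), (1,5,7,6,9), (3,4,6,5,11), (8,0,5,2,9)].map wheel)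
    (by decide +kernel)

theorem flexible_complete_13 : Flexible false (edgesOutside 13 0) (kiteB 13) :=
  flexible_of_completeCheck (n := 3)
    (C := [[(5,8,1,3), (2,6,11,1), (5,9,6,8)],
     [(5,8,1,11), (2,6,11,3), (6,9,5,11)],
     [(1,11,5,9), (2,6,11,3), (5,6,8,1)],
     [(1,3,11,2), (1,5,8,6), (6,9,5,11)],
     [(5,8,1,11), (2,6,11,3), (5,9,6,8)],
     [(1,3,11,2), (1,5,8,6), (6,11,5,9)]])
    (Ls := [(1,0,6,10,7), (1,2,4,9,12), (2,0,8,3,9), (3,0,5,12,10), (5,2,7,4,10), (6,3,4,12,7),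
     (9,7,8,10,11), (11,0,4,8,12)].map wheel)
    (by decide +kernel)

theorem flexible_complete_14 : Flexible false (edgesOutside 14 0) (kiteB 14) :=
  flexible_of_completeCheck (n := 4)
    (C := [[(0,7,4,13), (4,10,11,12), (7,10,8,5), (7,12,13,2)],
     [(4,7,13,12), (10,11,4,0), (7,10,8,4), (7,11,12,4)],
     [(0,4,7,10), (4,8,10,11), (4,12,11,7), (7,12,13,2)],
     [(0,7,4,13), (4,12,11,10), (7,10,8,4), (7,12,13,2)],
     [(0,7,4,8), (11,12,4,10), (7,8,10,11), (7,12,13,4)],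
     [(0,7,4,13), (4,10,8,5), (4,12,11,10), (7,12,13,2)],
     [(0,7,4,13), (4,10,8,5), (4,12,11,7), (7,12,13,2)]])
    (Ls := [(0,1,6,10,13), (0,2,3,8,11), (1,2,10,3,12), (3,4,6,7,9), (5,0,9,10,12), (5,1,4,2,7),
     (5,3,11,6,13), (6,2,8,12,9), (9,1,8,13,11)].map wheel)
    (by decide +kernel)

theorem flexible_complete_15 : Flexible false (edgesOutside 15 0) (kiteB 15) :=
  flexible_of_completeCheck (n := 6)
    (C := [[(0,7,14,8), (0,8,9,3), (1,12,9,2), (11,14,2,3), (3,11,6,5), (6,9,14,10)],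
     [(0,7,14,8), (0,8,9,1), (2,11,3,8), (2,14,9,12), (3,9,6,5), (6,11,14,10)],
     [(0,7,14,10), (0,9,8,14), (1,12,9,3), (2,11,3,8), (2,14,9,6), (11,14,6,5)],
     [(0,7,14,8), (1,12,9,2), (11,14,2,3), (3,11,6,5), (3,9,8,0), (6,9,14,10)],
     [(8,14,0,9), (1,12,9,2), (2,11,14,7), (3,11,6,5), (8,9,3,2), (6,9,14,10)],
     [(0,7,14,8), (0,9,8,3), (1,12,9,3), (11,14,2,3), (3,11,6,5), (6,9,14,10)],
     [(0,7,14,10), (0,8,9,2), (1,12,9,3), (11,14,2,3), (3,11,6,5), (6,9,14,8)],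
     [(0,7,14,10), (0,9,8,14), (1,12,9,3), (11,14,2,9), (6,11,3,2), (9,14,6,5)],
     [(0,7,14,8), (0,8,9,2), (1,12,9,3), (11,14,2,3), (3,11,6,5), (6,9,14,10)],
     [(0,7,14,8), (0,8,9,14), (1,12,9,2), (3,11,2,14), (3,9,6,5), (6,11,14,10)],
     [(8,14,0,7), (1,12,9,2), (11,14,2,3), (3,11,6,5), (3,8,9,0), (6,9,14,10)]])
    (Ls := [(0,1,3,12,11), (2,0,6,4,13), (4,0,5,3,10), (4,1,7,12,14), (5,1,2,12,10), (8,2,7,6,10),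
     (10,7,9,13,11), (11,4,8,5,9), (13,1,6,12,8), (13,3,7,5,14)].map wheel)
    (by decide +kernel)

theorem flexible_complete_16 : Flexible true (edgesOutside 16 0) (kiteB 16) :=
  flexible_of_completeCheck (n := 6)
    (C := [[(0,8,7,12), (11,12,0,1), (1,4,7,6), (1,8,14,0), (7,14,9,12), (8,9,11,13)],
     [(1,8,0,7), (11,12,0,14), (1,4,7,6), (7,8,14,1), (7,12,9,14), (8,9,11,13)],
     [(7,8,0,1), (0,12,11,13), (1,4,7,12), (1,8,14,0), (9,14,7,6), (8,11,9,12)],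
     [(7,12,0,14), (8,11,0,1), (1,4,7,6), (1,8,14,7), (7,8,9,14), (9,12,11,13)],
     [(0,1,14,8), (0,8,7,6), (0,11,12,9), (4,7,1,8), (9,14,7,12), (8,9,11,13)],
     [(7,8,0,1), (11,12,0,14), (1,4,7,6), (1,8,14,7), (7,12,9,14), (8,9,11,13)],
     [(0,8,7,12), (11,12,0,14), (1,4,7,6), (8,14,1,0), (7,14,9,12), (8,9,11,13)],
     [(0,8,7,6), (11,12,0,14), (1,4,7,14), (8,14,1,0), (7,12,9,14), (8,9,11,13)],
     [(7,8,0,14), (0,12,11,13), (1,4,7,14), (8,14,1,0), (9,12,7,6), (8,11,9,14)],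
     [(0,14,1,4), (0,12,7,6), (0,11,8,14), (1,8,7,4), (7,14,9,8), (9,12,11,13)],
     [(7,12,0,14), (8,11,0,1), (1,4,7,6), (1,14,8,9), (9,14,7,8), (9,12,11,13)]])
    (Ls := [(1,3,5,13,12), (4,0,3,9,5), (6,1,11,4,15), (6,3,8,5,10), (7,3,11,5,15), (9,0,2,1,10),
     (11,2,10,14,15), (12,2,5,14,6), (12,4,8,15,10), (13,0,6,9,15), (13,2,7,10,8),
     (14,2,3,13,4)].map wheel)
    (by decide +kernel)

theorem flexible_complete_17 : Flexible true (edgesOutside 17 0) (kiteB 17) :=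
  flexible_of_completeCheck (n := 6)
    (C := [[(0,6,13,14), (0,15,10,2), (1,4,2,11), (9,13,1,0), (1,11,15,4), (6,15,14,11)],
     [(10,15,0,1), (1,11,2,10), (1,15,4,2), (1,9,13,0), (13,14,6,0), (11,14,15,6)],
     [(6,13,0,1), (0,10,15,11), (1,11,2,10), (1,15,4,2), (1,9,13,14), (6,15,14,11)],
     [(0,13,6,15), (0,15,10,2), (1,11,2,4), (4,15,1,0), (1,9,13,14), (11,15,14,6)],
     [(6,15,0,10), (1,11,2,10), (1,15,4,2), (9,13,1,0), (6,14,13,0), (11,14,15,10)],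
     [(0,13,6,14), (10,15,0,1), (1,11,2,10), (1,15,4,2), (1,9,13,14), (11,14,15,6)],
     [(6,13,0,1), (0,15,10,2), (1,4,2,11), (1,9,13,14), (1,11,15,4), (6,15,14,11)],
     [(0,6,13,14), (0,15,10,2), (1,11,2,4), (1,4,15,6), (9,13,1,0), (11,15,14,6)],
     [(0,13,1,9), (6,15,0,10), (1,11,2,10), (1,15,4,2), (6,14,13,9), (11,14,15,10)],
     [(0,6,13,14), (0,15,10,2), (1,2,11,15), (1,15,4,2), (9,13,1,0), (6,15,14,11)]])
    (Ls := [(0,2,7,9,16), (0,3,8,14,12), (3,6,10,14,16), (4,11,12,13,16), (5,0,4,6,11),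
     (7,1,3,4,14), (8,1,5,7,6), (9,2,3,5,14), (9,4,8,11,10), (10,1,12,7,16), (12,2,6,9,15),
     (13,2,5,10,8), (13,3,11,7,15), (16,5,12,8,15)].map wheel)
    (by decide +kernel)

theorem flexible_complete_18 : Flexible false (edgesOutside 18 0) (kiteB 18) :=
  flexible_of_completeCheck (n := 6)
    (C := [[(1,14,0,17), (0,2,8,4), (5,13,0,16), (2,7,17,14), (8,14,5,9), (7,13,14,10)],
     [(1,14,0,16), (0,2,8,4), (5,13,0,17), (7,17,2,13), (5,8,14,10), (7,13,14,17)],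
     [(0,1,14,13), (2,17,0,8), (5,13,0,16), (7,13,2,8), (8,14,5,9), (7,17,14,10)],
     [(1,14,0,16), (2,17,0,13), (0,5,8,14), (7,13,2,8), (13,14,5,9), (7,17,14,10)],
     [(1,14,0,17), (0,2,8,4), (5,13,0,16), (2,7,13,14), (8,14,5,9), (7,17,14,10)],
     [(0,2,8,4), (5,13,0,16), (0,17,14,1), (7,17,2,13), (8,14,5,9), (7,13,14,10)],
     [(0,1,14,10), (2,8,0,16), (5,13,0,17), (7,17,2,13), (5,14,8,4), (7,13,14,17)],
     [(0,1,14,17), (0,2,8,4), (5,13,0,16), (7,17,2,13), (8,14,5,9), (7,13,14,10)],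
     [(1,14,0,16), (2,17,0,8), (0,13,5,9), (7,13,2,8), (5,8,14,10), (7,17,14,13)],
     [(0,1,14,13), (2,17,0,8), (5,13,0,16), (7,13,2,8), (5,14,8,4), (7,17,14,10)]])
    (Ls := [(3,0,4,9,12), (3,5,6,8,17), (4,1,10,5,12), (6,1,2,16,13), (6,4,7,9,17), (7,1,3,10,8),
     (9,8,11,14,16), (10,0,9,13,15), (11,0,6,15,7), (11,2,3,13,4), (12,2,10,6,14),
     (12,8,13,17,15), (15,1,5,2,9), (15,3,14,4,16), (16,5,7,12,11), (17,1,11,10,16)].map wheel)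
    (by decide +kernel)

theorem flexible_complete_19 : Flexible false (edgesOutside 19 0) (kiteB 19) :=
  flexible_of_completeCheck (n := 6)
    (C := [[(0,8,6,3), (5,17,3,12), (3,9,11,8), (11,17,6,15), (6,18,12,16), (8,17,9,5)],
     [(6,8,0,13), (3,5,17,9), (3,11,6,15), (3,12,9,5), (6,18,12,16), (8,11,17,6)],
     [(6,8,0,13), (3,5,17,8), (3,11,6,17), (3,9,12,16), (12,18,6,15), (11,17,9,5)],
     [(6,8,0,13), (5,17,3,6), (3,12,9,11), (6,17,11,3), (12,18,6,15), (9,17,8,11)],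
     [(3,9,12,16), (3,17,11,6), (9,17,5,3), (8,17,6,0), (12,18,6,15), (9,11,8,0)],
     [(6,8,0,13), (3,6,11,9), (3,9,12,16), (9,17,5,3), (12,18,6,15), (8,11,17,6)],
     [(6,8,0,13), (3,17,5,9), (3,6,11,9), (3,9,12,16), (12,18,6,15), (11,17,8,9)],
     [(0,6,8,9), (3,5,17,9), (3,11,6,15), (3,12,9,5), (6,18,12,16), (8,17,11,9)],
     [(6,8,0,13), (3,5,17,9), (3,6,11,9), (3,12,9,5), (6,18,12,16), (8,11,17,6)],
     [(6,8,0,13), (3,17,5,9), (3,6,12,16), (3,11,9,12), (11,17,6,18), (9,17,8,11)],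
     [(6,8,0,13), (3,17,5,9), (3,6,11,9), (3,9,12,16), (12,18,6,15), (9,17,8,11)]])
    (Ls := [(1,0,3,16,17), (1,5,10,12,15), (1,8,13,9,14), (2,0,15,9,18), (2,1,6,10,11),
     (2,3,7,5,14), (4,0,10,8,12), (4,1,7,11,18), (6,4,9,7,14), (8,3,15,7,18), (11,0,5,12,14),
     (12,2,13,7,17), (13,3,4,17,10), (13,5,6,16,18), (15,11,13,14,16), (16,0,7,10,9),
     (16,2,4,5,8), (18,10,14,17,15)].map wheel)
    (by decide +kernel)

theorem flexible_complete_20 : Flexible false (edgesOutside 20 0) (kiteB 20) :=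
  flexible_of_completeCheck (n := 3)
    (C := [[(1,2,3,0), (2,11,4,16), (11,16,14,2)],
     [(2,3,0,1), (2,11,4,16), (11,16,14,2)],
     [(1,2,3,0), (4,11,2,0), (11,16,14,2)],
     [(1,3,2,14), (4,11,2,0), (11,14,16,4)],
     [(1,2,3,0), (11,14,2,0), (11,16,4,2)]])
    (Ls := [(4,0,14,9,19), (5,0,15,10,16), (6,0,12,11,17), (7,0,13,8,18), (0,8,9,10,11),
     (1,4,5,6,7), (16,1,8,6,15), (17,1,9,7,12), (18,1,10,4,13), (19,1,11,5,14), (8,2,5,17,15),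
     (9,2,6,18,12), (10,2,7,19,13), (2,16,17,18,19), (3,4,6,19,17), (3,5,7,16,18), (3,8,10,12,14),
     (3,9,11,13,15), (12,4,8,19,15), (13,5,9,16,12), (14,6,10,17,13), (15,7,11,18,14)].map wheel)
    (by decide +kernel)

theorem flexible_complete_21 : Flexible false (edgesOutside 21 0) (kiteB 21) :=
  flexible_of_completeCheck (n := 6)
    (C := [[(5,15,2,14), (3,9,15,19), (4,9,5,11), (4,10,11,15), (12,15,4,3), (7,12,9,18)],
     [(3,4,2,14), (2,15,5,4), (3,15,9,18), (4,10,11,5), (4,12,15,11), (7,12,9,4)],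
     [(3,15,2,14), (2,5,4,15), (3,4,9,5), (10,11,4,12), (5,11,15,9), (7,12,9,18)],
     [(2,15,3,4), (4,5,2,14), (10,11,4,9), (4,12,15,19), (9,15,5,11), (7,12,9,18)],
     [(3,4,2,14), (2,5,15,11), (3,9,15,19), (4,11,5,9), (12,15,4,10), (7,12,9,18)],
     [(3,4,2,14), (2,15,5,11), (3,9,15,19), (10,11,4,9), (12,15,4,5), (7,12,9,18)],
     [(3,4,2,14), (2,5,15,11), (3,15,9,18), (4,11,5,9), (4,12,15,19), (7,12,9,4)],
     [(2,3,4,5), (5,15,2,14), (3,9,15,19), (4,10,11,15), (12,15,4,9), (7,12,9,18)],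
     [(3,4,2,14), (3,9,15,19), (5,9,4,15), (10,11,4,12), (5,11,15,2), (7,12,9,18)],
     [(3,4,2,14), (2,5,15,11), (3,9,15,19), (5,9,4,15), (10,11,4,12), (7,12,9,18)],
     [(3,4,2,14), (2,5,15,11), (3,15,9,18), (4,11,5,9), (12,15,4,10), (7,12,9,4)],
     [(3,15,2,14), (2,5,4,12), (3,4,9,7), (10,11,4,15), (5,11,15,19), (9,15,12,7)]])
    (Ls := [(0,3,10,9,14), (0,4,16,13,18), (1,0,8,3,20), (1,6,9,17,16), (3,5,12,13,19),
     (6,5,18,15,20), (6,7,8,11,13), (8,5,10,15,16), (8,12,18,17,19), (9,2,11,19,16),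
     (11,0,7,1,12), (12,2,6,14,17), (13,1,4,14,10), (13,2,8,9,20), (14,1,5,7,15), (16,3,11,14,18),
     (16,7,10,12,20), (17,0,5,13,15), (17,3,6,4,7), (18,1,2,7,19), (19,0,2,10,6), (20,4,8,14,19),
     (20,10,17,11,18)].map wheel)
    (by decide +kernel)

theorem flexible_complete_22 : Flexible false (edgesOutside 22 0) (kiteB 22) :=
  flexible_of_completeCheck (n := 3)
    (C := [[(0,3,1,2), (0,4,2,3), (1,4,5,2)],
     [(0,2,4,1), (3,5,0,1), (1,5,2,3)],
     [(0,3,1,2), (0,2,5,1), (2,3,4,0)],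
     [(0,1,3,5), (1,4,5,2), (3,4,2,1)],
     [(0,3,1,2), (1,4,5,2), (3,4,2,0)],
     [(0,3,1,2), (1,4,5,3), (3,4,2,0)]])
    (Ls := [(18,0,6,11,20), (19,1,7,9,18), (20,2,8,10,19), (15,2,6,5,9), (16,0,7,3,10),
     (17,1,8,4,11), (0,8,9,11,13), (1,6,10,9,14), (2,7,11,10,12), (18,2,14,7,17), (19,0,12,8,15),
     (20,1,13,6,16), (21,0,14,10,17), (21,1,12,11,15), (21,2,13,9,16), (3,6,8,18,21),
     (4,6,7,21,19), (5,7,8,21,20), (15,4,10,7,13), (16,5,11,8,14), (17,3,9,6,12), (18,5,10,13,12),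
     (19,3,11,14,13), (20,4,9,12,14), (15,3,14,17,20), (16,4,12,15,18), (17,5,13,16,19)].map
     wheel)
    (by decide +kernel)

theorem flexible_complete_23 : Flexible false (edgesOutside 23 0) (kiteB 23) :=
  flexible_of_completeCheck (n := 5)
    (C := [[(0,2,1,4), (0,6,3,2), (0,4,5,2), (3,5,1,6), (2,4,6,5)],
     [(1,2,0,4), (1,3,6,0), (1,4,5,6), (2,5,3,0), (2,6,4,3)],
     [(2,5,0,1), (0,6,3,1), (1,4,2,6), (1,5,6,4), (3,5,4,0)],
     [(1,2,0,4), (0,6,3,1), (1,6,5,0), (2,3,5,4), (2,6,4,3)],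
     [(1,2,0,4), (0,6,3,1), (4,5,1,6), (2,3,5,0), (2,4,6,5)],
     [(1,2,0,4), (0,6,3,1), (4,5,1,6), (2,4,3,5), (2,5,6,4)],
     [(1,2,0,4), (0,6,3,1), (1,6,5,4), (2,3,5,0), (2,6,4,1)],
     [(1,2,0,4), (0,6,3,1), (1,6,5,4), (2,3,5,0), (2,6,4,3)],
     [(0,2,1,4), (3,6,0,4), (1,6,5,0), (2,5,3,4), (2,6,4,5)],
     [(1,2,0,4), (0,6,3,1), (1,4,5,6), (2,3,5,0), (2,6,4,3)]])
    (Ls := [(7,0,12,16,13), (8,1,13,17,14), (9,2,11,18,14), (10,3,11,15,12), (19,2,7,3,17),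
     (20,0,8,3,18), (21,0,9,1,15), (22,1,10,2,16), (0,10,17,16,19), (1,7,18,17,20),
     (2,8,15,18,21), (3,9,16,15,22), (11,1,12,8,19), (12,2,13,9,20), (13,3,14,10,21),
     (14,0,11,7,22), (4,7,9,19,21), (5,8,10,20,22), (4,8,16,10,18), (5,7,15,9,17),
     (4,11,20,13,22), (5,12,19,14,21), (4,12,14,15,17), (5,11,13,18,16), (6,7,8,9,10),
     (15,6,13,19,20), (16,6,14,20,21), (17,6,11,21,22), (18,6,12,22,19)].map wheel)
    (by decide +kernel)

/-! ### Complete graphs with a hole -/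

theorem isKiteUnit_hole_0 :
    ∃ E, IsKiteUnit E 7 ∧ E ⊆ edgesOutside 8 0 :=
  ⟨_, isKiteUnit_of_unitCheck (v := 8) (w := 0) (n := 7)
    (L := addWheels [(0,2,5,3,6)]
      [[(0,1,4,2), (1,3,2,7), (1,6,7,5), (3,4,7,0), (4,6,5,1)],
       [(1,4,0,7), (2,3,1,5), (1,6,7,2), (3,7,4,2), (4,6,5,7)],
       [(0,4,7,3), (2,7,1,6), (4,5,1,0), (2,4,3,1), (5,7,6,4)]])
    (by decide +kernel)⟩

theorem isKiteUnit_hole_1 :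
    ∃ E, IsKiteUnit E 9 ∧ E ⊆ edgesOutside 9 1 :=
  ⟨_, isKiteUnit_of_unitCheck (v := 9) (w := 1) (n := 9)
    (L := addWheels [(0,1,5,8,7)]
      [[(2,4,0,6), (1,8,3,2), (1,6,4,5), (5,7,2,1), (2,6,8,4), (3,4,7,6), (5,6,3,0)],
       [(0,2,4,8), (1,8,3,0), (4,6,1,2), (5,7,2,3), (2,8,6,0), (3,7,4,5), (3,5,6,7)],
       [(4,6,0,3), (1,6,2,0), (1,8,4,2), (2,3,7,4), (4,5,3,1), (3,6,8,2), (6,7,5,2)]])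
    (by decide +kernel)⟩

theorem isKiteUnit_hole_2 :
    ∃ E, IsKiteUnit E 11 ∧ E ⊆ edgesOutside 10 2 :=
  ⟨_, isKiteUnit_of_unitCheck (v := 10) (w := 2) (n := 11)
    (L := addWheels [(0,2,4,3,5), (1,4,5,6,7), (7,0,8,5,9)]
      [[(2,8,1,3), (2,7,3,6), (2,6,9,4), (3,8,9,1), (4,8,6,0)],
       [(2,8,1,9), (2,7,3,1), (2,9,6,0), (8,9,3,6), (6,8,4,9)],
       [(1,9,2,7), (1,8,3,7), (2,8,6,0), (6,9,3,2), (8,9,4,6)]])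
    (by decide +kernel)⟩

theorem isKiteUnit_hole_3 :
    ∃ E, IsKiteUnit E 13 ∧ E ⊆ edgesOutside 11 3 :=
  ⟨_, isKiteUnit_of_unitCheck (v := 11) (w := 3) (n := 13)
    (L := addWheels [(0,4,5,8,10), (3,0,6,4,7), (8,1,4,2,7), (9,1,3,8,6)]
      [[(1,5,10,6), (2,10,3,5), (2,5,9,4), (5,7,6,2), (7,10,9,0)],
       [(1,10,5,3), (3,10,2,6), (2,5,9,0), (5,7,6,10), (7,10,9,4)],
       [(2,6,5,1), (2,10,9,4), (5,10,3,2), (5,7,9,0), (6,7,10,1)]])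
    (by decide +kernel)⟩

theorem isKiteUnit_hole_4 :
    ∃ E, IsKiteUnit E 15 ∧ E ⊆ edgesOutside 12 4 :=
  ⟨_, isKiteUnit_of_unitCheck (v := 12) (w := 4) (n := 15)
    (L := addWheels [(2,5,6,11,7), (5,0,8,3,11), (6,0,7,3,10), (10,2,8,7,9)]
      [[(0,9,4,3), (4,7,1,11), (1,10,5,9), (6,9,1,8), (6,8,4,2), (10,11,4,5), (8,11,9,3)],
       [(0,4,9,5), (1,7,4,2), (1,10,5,4), (1,6,9,3), (4,6,8,1), (10,11,4,3), (8,9,11,1)],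
       [(1,6,4,7), (5,9,1,7), (1,10,11,9), (3,9,4,0), (5,10,4,2), (4,11,8,1), (6,8,9,0)]])
    (by decide +kernel)⟩

theorem isKiteUnit_hole_5 :
    ∃ E, IsKiteUnit E 17 ∧ E ⊆ edgesOutside 13 5 :=
  ⟨_, isKiteUnit_of_unitCheck (v := 13) (w := 5) (n := 17)
    (L := addWheels [(2,5,10,6,11), (2,7,8,9,12), (5,0,6,4,8), (9,3,5,7,6), (10,0,7,4,9)]
      [[(0,11,12,6), (6,8,1,5), (1,9,11,4), (1,10,12,5), (3,11,7,1), (3,8,12,4), (8,11,10,3)],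
       [(0,11,12,4), (6,8,1,7), (9,11,1,5), (1,10,12,6), (7,11,3,10), (3,8,12,5), (8,10,11,4)],
       [(5,12,1,9), (1,11,7,3), (8,10,1,6), (3,8,11,0), (3,12,10,11), (4,12,11,9), (6,8,12,0)]])
    (by decide +kernel)⟩

theorem isKiteUnit_hole_6 :
    ∃ E, IsKiteUnit E 19 ∧ E ⊆ edgesOutside 14 6 :=
  ⟨_, isKiteUnit_of_unitCheck (v := 14) (w := 6) (n := 19)
    (L := addWheels [(3,6,8,12,13), (3,7,9,10,11), (4,6,7,10,12), (10,0,6,2,8), (11,1,6,5,12),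
     (13,1,7,5,10)]
      [[(0,12,7,8), (0,13,9,5), (1,9,8,11), (9,12,2,7), (2,13,11,0), (4,13,8,5), (4,11,9,6)],
       [(0,12,7,2), (0,13,9,6), (1,9,8,5), (2,12,9,5), (2,13,11,8), (4,13,8,7), (4,9,11,0)],
       [(0,12,9,6), (0,11,13,2), (2,12,7,0), (2,11,9,1), (4,11,8,1), (4,9,13,8), (5,9,8,7)]])
    (by decide +kernel)⟩

theorem isKiteUnit_hole_7 :
    ∃ E, IsKiteUnit E 21 ∧ E ⊆ edgesOutside 15 7 :=
  ⟨_, isKiteUnit_of_unitCheck (v := 15) (w := 7) (n := 21)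
    (L := addWheels [(0,7,8,13,14), (10,0,9,5,12), (11,1,7,9,12), (12,4,7,6,13), (13,1,9,3,10),
     (13,2,7,5,11)]
      [[(2,8,10,7), (2,9,14,12), (3,8,12,2), (11,14,3,7), (4,8,9,6), (10,11,4,14), (5,14,8,1),
        (6,8,11,0), (6,10,14,1)],
       [(8,10,2,12), (2,9,14,1), (8,12,3,7), (3,14,11,0), (8,9,4,14), (4,11,10,7), (5,8,14,12),
        (6,11,8,1), (10,14,6,9)],
       [(1,14,8,5), (8,12,2,9), (2,14,10,7), (8,11,3,7), (3,12,14,6), (8,10,4,9), (4,11,14,5),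
        (6,8,9,14), (6,10,11,0)]])
    (by decide +kernel)⟩

/-! ### Blocks as subgraphs -/

/-- The subgraph of the complete graph formed by a block. -/
def KiteBlock.toSubgraph {V : Type*} (p : KiteBlock V) : (⊤ : SimpleGraph V).Subgraph where
  verts := {x | x ∈ p.1 ∨ x ∈ p.2}
  Adj x y := x ≠ y ∧ s(x, y) ∈ p.edges
  adj_sub h := h.1
  edge_vert := by
    rintro x y ⟨-, ⟨h, -⟩ | h⟩
    · exact Or.inl (h x (by simp))
    · exact Or.inr (h ▸ by simp)
  symm := ⟨fun x y h => ⟨h.1.symm, Sym2.eq_swap (a := x) (b := y) ▸ h.2⟩⟩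

theorem edgeSet_toSubgraph {V : Type*} [DecidableEq V] {k : V × V × V × V} (hk : IsKiteTuple k) :
    (kiteBlock k).toSubgraph.edgeSet = (kiteBlock k).edges := by
  ext e
  induction e using Sym2.ind with
  | _ x y =>
    rw [SimpleGraph.Subgraph.mem_edgeSet]
    refine ⟨fun h => h.2, fun h => ⟨?_, h⟩⟩
    rintro rfl
    rw [mem_edges_kiteBlock hk] at h
    obtain ⟨a, b, c, d⟩ := k
    simp only [IsKiteTuple, List.nodup_cons, List.mem_cons, List.not_mem_nil, or_false, not_or,
      not_false_eq_true, List.nodup_nil, and_true] at hk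
    simp only [kiteEdges, List.mem_cons, List.not_mem_nil, or_false, Sym2.eq_iff] at h
    grind

theorem cliqueSet_toSubgraph {V : Type*} [DecidableEq V] {k : V × V × V × V}
    (hk : IsKiteTuple k) :
    (kiteBlock k).toSubgraph.spanningCoe.cliqueSet 3 = {(kiteBlock k).1} := by
  have hadj : ∀ x y, (kiteBlock k).toSubgraph.spanningCoe.Adj x y ↔ s(x, y) ∈ kiteEdges k := by
    intro x y
    rw [SimpleGraph.Subgraph.spanningCoe_adj, ← SimpleGraph.Subgraph.mem_edgeSet,
      edgeSet_toSubgraph hk, mem_edges_kiteBlock hk]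
  ext T
  rw [SimpleGraph.mem_cliqueSet_iff, SimpleGraph.is3Clique_iff, Set.mem_singleton_iff]
  simp only [hadj]
  obtain ⟨a, b, c, d⟩ := k
  simp only [IsKiteTuple, List.nodup_cons, List.mem_cons, List.not_mem_nil, or_false, not_or,
    not_false_eq_true, List.nodup_nil, and_true] at hk
  simp only [kiteEdges, List.mem_cons, List.not_mem_nil, or_false, Sym2.eq_iff, kiteBlock]
  constructor
  · rintro ⟨x, y, z, h1, h2, h3, rfl⟩
    have h : x ≠ y ∧ x ≠ z ∧ y ≠ z ∧ x ≠ d ∧ y ≠ d ∧ z ≠ d := by grind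
    have h' : (x = a ∨ x = b ∨ x = c) ∧ (y = a ∨ y = b ∨ y = c) ∧ (z = a ∨ z = b ∨ z = c) := by
      grind
    refine Finset.eq_of_subset_of_card_le ?_ ?_
    · intro w hw
      simp only [Finset.mem_insert, Finset.mem_singleton] at hw ⊢
      grind
    · rw [Finset.card_eq_three.2 ⟨x, y, z, h.1, h.2.1, h.2.2.1, rfl⟩]
      exact Finset.card_le_three
  · rintro rfl
    exact ⟨a, b, c, by simp, by simp, by simp, rfl⟩

/-- A block is determined by its edges: they contain only one triangle. -/
theorem toSubgraph_injective {V : Type*} [DecidableEq V] {k l : V × V × V × V}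
    (hk : IsKiteTuple k) (hl : IsKiteTuple l)
    (h : (kiteBlock k).edges = (kiteBlock l).edges) : kiteBlock k = kiteBlock l := by
  have h1 : (kiteBlock k).1 = (kiteBlock l).1 := by
    have h2 : (kiteBlock k).toSubgraph.spanningCoe = (kiteBlock l).toSubgraph.spanningCoe := by
      ext x y
      rw [SimpleGraph.Subgraph.spanningCoe_adj, ← SimpleGraph.Subgraph.mem_edgeSet,
        SimpleGraph.Subgraph.spanningCoe_adj, ← SimpleGraph.Subgraph.mem_edgeSet,
        edgeSet_toSubgraph hk, edgeSet_toSubgraph hl, h]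
    have h3 := cliqueSet_toSubgraph hk
    rw [h2, cliqueSet_toSubgraph hl] at h3
    exact (Set.singleton_injective h3).symm
  refine Prod.ext h1 ?_
  -- the pendant edge is the only edge that leaves the triangle
  rcases h ▸ (kiteBlock k).snd_mem_edges with ⟨h4, -⟩ | h4
  · exfalso
    rw [← h1] at h4
    obtain ⟨a, b, c, d⟩ := k
    simp only [IsKiteTuple, List.nodup_cons, List.mem_cons, List.not_mem_nil, or_false, not_or,
      not_false_eq_true, List.nodup_nil, and_true] at hk
    have := h4 d (by simp [kiteBlock])
    simp only [kiteBlock, Finset.mem_insert, Finset.mem_singleton] at this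
    grind
  · exact h4

theorem kite_adj (i j : Fin 4) : kite.Adj i j ↔
    s(i, j) = s(0, 1) ∨ s(i, j) = s(0, 2) ∨ s(i, j) = s(1, 2) ∨ s(i, j) = s(2, 3) := by
  simp only [kite, SimpleGraph.fromEdgeSet_adj, Set.mem_insert_iff, Set.mem_singleton_iff]
  revert i j
  decide

theorem nonempty_iso_toSubgraph {V : Type*} [DecidableEq V] {k : V × V × V × V}
    (hk : IsKiteTuple k) : Nonempty ((kiteBlock k).toSubgraph.coe ≃g kite) := by
  have hv : ∀ x, x ∈ (kiteBlock k).toSubgraph.verts ↔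
      x = k.1 ∨ x = k.2.1 ∨ x = k.2.2.1 ∨ x = k.2.2.2 := by
    intro x
    simp only [KiteBlock.toSubgraph, kiteBlock, Finset.mem_insert, Finset.mem_singleton,
      Sym2.mem_iff, Set.mem_ofPred_eq]
    tauto
  have hadj : ∀ x y, (kiteBlock k).toSubgraph.Adj x y ↔ s(x, y) ∈ kiteEdges k := by
    intro x y
    rw [← SimpleGraph.Subgraph.mem_edgeSet, edgeSet_toSubgraph hk, mem_edges_kiteBlock hk]
  have hf : Function.Injective ![k.1, k.2.1, k.2.2.1, k.2.2.2] := by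
    have h : ![k.1, k.2.1, k.2.2.1, k.2.2.2] = [k.1, k.2.1, k.2.2.1, k.2.2.2].get := by
      funext i
      fin_cases i <;> rfl
    rw [h]
    exact List.nodup_iff_injective_get.1 hk
  let f : Fin 4 → (kiteBlock k).toSubgraph.verts :=
    fun i => ⟨![k.1, k.2.1, k.2.2.1, k.2.2.2] i, by
      rw [hv]; fin_cases i <;> simp⟩
  have hbij : Function.Bijective f := by
    refine ⟨fun i j h => hf (congrArg Subtype.val h), ?_⟩
    rintro ⟨x, hx⟩
    rcases (hv x).1 hx with rfl | rfl | rfl | rfl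
    · exact ⟨0, rfl⟩
    · exact ⟨1, rfl⟩
    · exact ⟨2, rfl⟩
    · exact ⟨3, rfl⟩
  refine ⟨(RelIso.symm ⟨Equiv.ofBijective f hbij, ?_⟩)⟩
  intro i j
  rw [kite_adj]
  change (kiteBlock k).toSubgraph.Adj (f i) (f j) ↔ _
  rw [hadj]
  have h1 : ∀ i j, s((f i : V), (f j : V)) = Sym2.map ![k.1, k.2.1, k.2.2.1, k.2.2.2] s(i, j) :=
    fun i j => rfl
  have h2 : kiteEdges k = [s(0, 1), s(0, 2), s(1, 2), s(2, 3)].map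
    (Sym2.map ![k.1, k.2.1, k.2.2.1, k.2.2.2]) := rfl
  rw [h1, h2, List.mem_map_of_injective (Sym2.map.injective hf)]
  simp

theorem exists_toSubgraph_of_iso {V : Type*} [DecidableEq V] {B : (⊤ : SimpleGraph V).Subgraph}
    (hB : Nonempty (B.coe ≃g kite)) : ∃ k, IsKiteTuple k ∧ B = (kiteBlock k).toSubgraph := by
  obtain ⟨φ⟩ := hB
  set g : Fin 4 → V := fun i => (φ.symm i : V)
  have hg : Function.Injective g := Subtype.val_injective.comp φ.symm.injective
  have hk : IsKiteTuple (g 0, g 1, g 2, g 3) :=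
    List.Nodup.map hg (by decide : [(0 : Fin 4), 1, 2, 3].Nodup)
  have hv : ∀ x, x ∈ B.verts ↔ ∃ i, g i = x := by
    intro x
    refine ⟨fun hx => ⟨φ ⟨x, hx⟩, by simp [g]⟩, ?_⟩
    rintro ⟨i, rfl⟩
    exact (φ.symm i).2
  have hadj : ∀ i j, B.Adj (g i) (g j) ↔ kite.Adj i j := fun i j => φ.symm.map_rel_iff
  refine ⟨_, hk, ?_⟩
  have hadj' : ∀ x y, (kiteBlock (g 0, g 1, g 2, g 3)).toSubgraph.Adj x y ↔
      s(x, y) ∈ kiteEdges (g 0, g 1, g 2, g 3) := by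
    intro x y
    rw [← SimpleGraph.Subgraph.mem_edgeSet, edgeSet_toSubgraph hk, mem_edges_kiteBlock hk]
  have h2 : kiteEdges (g 0, g 1, g 2, g 3) = [s(0, 1), s(0, 2), s(1, 2), s(2, 3)].map
    (Sym2.map g) := rfl
  refine SimpleGraph.Subgraph.ext ?_ ?_
  · ext x
    rw [hv]
    simp only [KiteBlock.toSubgraph, kiteBlock, Finset.mem_insert, Finset.mem_singleton,
      Sym2.mem_iff, Set.mem_ofPred_eq, Fin.exists_fin_succ, Fin.exists_fin_zero]
    simp only [Fin.isValue, Fin.succ_zero_eq_one, Fin.succ_one_eq_two, eq_comm (a := x)]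
    have : ((2 : Fin 3).succ) = (3 : Fin 4) := rfl
    tauto
  · ext x y
    rw [hadj']
    constructor
    · intro h
      obtain ⟨i, rfl⟩ := (hv x).1 (B.edge_vert h)
      obtain ⟨j, rfl⟩ := (hv y).1 (B.edge_vert h.symm)
      rw [hadj, kite_adj] at h
      rw [h2, show s(g i, g j) = Sym2.map g s(i, j) from rfl,
        List.mem_map_of_injective (Sym2.map.injective hg)]
      simpa using h
    · intro h
      rw [h2, List.mem_map] at h
      obtain ⟨e, he, hxy⟩ := h
      induction e using Sym2.ind with
      | _ i j =>
        have h3 : kite.Adj i j := by rw [kite_adj]; simpa using he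
        rw [← hadj] at h3
        rw [Sym2.map_mk, Sym2.eq_iff] at hxy
        rcases hxy with ⟨rfl, rfl⟩ | ⟨rfl, rfl⟩
        · exact h3
        · exact h3.symm

/-! ### Maximum packings of the complete graph -/

theorem ncard_edges_kiteBlock {V : Type*} [DecidableEq V] {k : V × V × V × V}
    (hk : IsKiteTuple k) : (kiteBlock k).edges.ncard = 4 := by
  have h : (kiteBlock k).edges = ((kiteEdges k).toFinset : Set (Sym2 V)) := by
    ext e
    rw [mem_edges_kiteBlock hk, Finset.mem_coe, List.mem_toFinset]
  rw [h, Set.ncard_coe_finset, List.toFinset_card_of_nodup]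
  · rfl
  · obtain ⟨a, b, c, d⟩ := k
    simp only [IsKiteTuple, List.nodup_cons, List.mem_cons, List.not_mem_nil, or_false, not_or,
      not_false_eq_true, List.nodup_nil, and_true] at hk
    simp only [kiteEdges, List.nodup_cons, List.mem_cons, List.not_mem_nil, or_false, not_or,
      not_false_eq_true, List.nodup_nil, and_true, Sym2.eq_iff]
    grind

theorem IsPacking.eq_of_mem {X : Type*} [Finite X] {ℬ : Set (⊤ : SimpleGraph X).Subgraph}
    (h : IsPacking kite ℬ) {A B : (⊤ : SimpleGraph X).Subgraph} (hA : A ∈ ℬ) (hB : B ∈ ℬ)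
    {e : Sym2 X} (heA : e ∈ A.edgeSet) (heB : e ∈ B.edgeSet) : A = B :=
  h.edge e (A.edgeSet_subset heA) ⟨hA, heA⟩ ⟨hB, heB⟩

theorem IsPacking.ncard_iUnion_edgeSet {X : Type*} [Finite X]
    {ℬ : Set (⊤ : SimpleGraph X).Subgraph} (h : IsPacking kite ℬ) :
    (⋃ B ∈ ℬ, B.edgeSet).ncard = 4 * ℬ.ncard := by
  classical
  have := Fintype.ofFinite X
  have hfin : ℬ.Finite := Set.toFinite ℬ
  have h1 : (⋃ B ∈ ℬ, B.edgeSet) =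
      (hfin.toFinset.biUnion fun B => B.edgeSet.toFinset : Finset (Sym2 X)) := by
    ext e
    simp
  rw [h1, Set.ncard_coe_finset, Finset.card_biUnion, Finset.sum_const_nat (m := 4),
    ← Set.ncard_eq_toFinset_card ℬ hfin, mul_comm]
  · intro B hB
    obtain ⟨k, hk, rfl⟩ := exists_toSubgraph_of_iso (h.iso B (hfin.mem_toFinset.1 hB))
    rw [← Set.ncard_eq_toFinset_card', edgeSet_toSubgraph hk, ncard_edges_kiteBlock hk]
  · intro A hA B hB hAB
    refine Finset.disjoint_left.2 fun e he he' => hAB ?_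
    exact h.eq_of_mem (hfin.mem_toFinset.1 hA) (hfin.mem_toFinset.1 hB)
      (Set.mem_toFinset.1 he) (Set.mem_toFinset.1 he')

theorem ncard_edgeSet_top (v : ℕ) :
    (⊤ : SimpleGraph (Fin v)).edgeSet.ncard = v * (v - 1) / 2 := by
  rw [Set.ncard_eq_toFinset_card', ← SimpleGraph.edgeFinset,
    SimpleGraph.card_edgeFinset_top_eq_card_choose_two, Fintype.card_fin, Nat.choose_two_right]

theorem IsPacking.ncard_le {v : ℕ} {ℬ : Set (⊤ : SimpleGraph (Fin v)).Subgraph}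
    (h : IsPacking kite ℬ) : ℬ.ncard ≤ kiteB v := by
  have h1 : (⋃ B ∈ ℬ, B.edgeSet).ncard ≤ (⊤ : SimpleGraph (Fin v)).edgeSet.ncard :=
    Set.ncard_le_ncard (Set.iUnion₂_subset fun B _ => B.edgeSet_subset) (Set.toFinite _)
  rw [h.ncard_iUnion_edgeSet, ncard_edgeSet_top] at h1
  rw [kiteB]
  omega

/-- Every block of a packing contains exactly one triangle. -/
theorem triangles_eq_image {X : Type*} [Finite X] {ℬ : Set (⊤ : SimpleGraph X).Subgraph}
    (h : IsPacking kite ℬ) :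
    ∃ τ : (⊤ : SimpleGraph X).Subgraph → Finset X, triangles ℬ = τ '' ℬ ∧
      ∀ B ∈ ℬ, B.spanningCoe.cliqueSet 3 = {τ B} := by
  classical
  have h1 : ∀ B ∈ ℬ, ∃ T : Finset X, B.spanningCoe.cliqueSet 3 = {T} := by
    intro B hB
    obtain ⟨k, hk, rfl⟩ := exists_toSubgraph_of_iso (h.iso B hB)
    exact ⟨_, cliqueSet_toSubgraph hk⟩
  choose! τ hτ using h1
  refine ⟨τ, ?_, hτ⟩
  ext T
  simp only [triangles, Set.mem_iUnion, Set.mem_image, exists_prop]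
  refine exists_congr fun B => and_congr_right fun hB => ?_
  rw [hτ B hB, Set.mem_singleton_iff, eq_comm]

theorem IsPacking.ncard_triangles_le {X : Type*} [Finite X]
    {ℬ : Set (⊤ : SimpleGraph X).Subgraph} (h : IsPacking kite ℬ) :
    (triangles ℬ).ncard ≤ ℬ.ncard := by
  obtain ⟨τ, hτ, -⟩ := triangles_eq_image h
  rw [hτ]
  exact Set.ncard_image_le (Set.toFinite _)

/-- The subgraphs formed by the blocks of a kite system are a packing. -/
theorem IsKiteSystem.isPacking {X : Type*} [Finite X] [DecidableEq X] {E : Set (Sym2 X)}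
    {P : Finset (KiteBlock X)} (hP : IsKiteSystem E P) :
    IsPacking kite (KiteBlock.toSubgraph '' (P : Set (KiteBlock X))) := by
  refine ⟨?_, ?_⟩
  · rintro _ ⟨p, hp, rfl⟩
    obtain ⟨k, hk, rfl⟩ := hP.exists_tuple p hp
    exact nonempty_iso_toSubgraph hk
  · rintro e - _ ⟨⟨p, hp, rfl⟩, he⟩ _ ⟨⟨q, hq, rfl⟩, he'⟩
    obtain ⟨k, hk, rfl⟩ := hP.exists_tuple p hp
    obtain ⟨l, hl, rfl⟩ := hP.exists_tuple q hq
    rw [edgeSet_toSubgraph hk] at he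
    rw [edgeSet_toSubgraph hl] at he'
    rw [hP.eq_of_mem _ hp _ hq e he he']

theorem IsKiteSystem.triangles_eq {X : Type*} [Finite X] [DecidableEq X] {E : Set (Sym2 X)}
    {P : Finset (KiteBlock X)} (hP : IsKiteSystem E P) :
    triangles (KiteBlock.toSubgraph '' (P : Set (KiteBlock X))) =
      (P.image Prod.fst : Finset (Finset X)) := by
  ext T
  rw [triangles, Set.biUnion_image]
  simp only [Set.mem_iUnion, exists_prop, Finset.coe_image, Set.mem_image, Finset.mem_coe]
  refine exists_congr fun p => and_congr_right fun hp => ?_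
  obtain ⟨k, hk, rfl⟩ := hP.exists_tuple p hp
  rw [cliqueSet_toSubgraph hk, Set.mem_singleton_iff, eq_comm]

/-- Packings that attain the upper bound `kiteB v` are maximum. -/
theorem mem_kiteFin_of_realizes {v s u : ℕ}
    (h : Realizes (⊤ : SimpleGraph (Fin v)).edgeSet (kiteB v) s u) (hsu : s ≤ u) :
    (s, u - s) ∈ kiteFin v := by
  obtain ⟨P, Q, hP, hQ, hPn, hQn, rfl, rfl⟩ := h
  have hinj : Set.InjOn KiteBlock.toSubgraph ((P ∪ Q : Finset _) : Set (KiteBlock (Fin v))) := by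
    have hk : ∀ p ∈ P ∪ Q, ∃ k, IsKiteTuple k ∧ p = kiteBlock k := fun p hp =>
      (Finset.mem_union.1 hp).elim (hP.exists_tuple p) (hQ.exists_tuple p)
    intro p hp q hq hpq
    obtain ⟨k, hk', rfl⟩ := hk p hp
    obtain ⟨l, hl, rfl⟩ := hk q hq
    refine toSubgraph_injective hk' hl ?_
    rw [← edgeSet_toSubgraph hk', ← edgeSet_toSubgraph hl, hpq]
  have hmax : ∀ P : Finset (KiteBlock (Fin v)), IsKiteSystem
      (⊤ : SimpleGraph (Fin v)).edgeSet P → P.card = kiteB v →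
      Set.InjOn KiteBlock.toSubgraph (P : Set (KiteBlock (Fin v))) →
      IsMaximumPacking kite (KiteBlock.toSubgraph '' (P : Set (KiteBlock (Fin v)))) := by
    intro P hP hPn hinj
    refine ⟨hP.isPacking, fun ℬ' h' => h'.ncard_le.trans_eq ?_⟩
    rw [Set.InjOn.ncard_image hinj, Set.ncard_coe_finset, hPn]
  refine ⟨_, _, hmax P hP hPn (hinj.mono (by simp)), hmax Q hQ hQn (hinj.mono (by simp)), ?_, ?_⟩
  · rw [← Set.InjOn.image_inter hinj (by simp) (by simp), Set.InjOn.ncard_image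
      (hinj.mono (Set.inter_subset_left.trans (by simp))), ← Finset.coe_inter,
      Set.ncard_coe_finset]
  · rw [hP.triangles_eq, hQ.triangles_eq, ← Finset.coe_inter, Set.ncard_coe_finset]
    change _ = _ + (_ - _)
    omega

/-- If the edges of the complete graph are used up by both packings, the packings cannot differ in
exactly one block: the edges outside the common blocks determine the remaining block. -/
theorem ncard_inter_ne {v : ℕ} (hv : 4 * kiteB v = v * (v - 1) / 2) (hb : 1 ≤ kiteB v)
    {ℬ₁ ℬ₂ : Set (⊤ : SimpleGraph (Fin v)).Subgraph} (h₁ : IsPacking kite ℬ₁)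
    (h₂ : IsPacking kite ℬ₂) (hn₁ : ℬ₁.ncard = kiteB v) (hn₂ : ℬ₂.ncard = kiteB v) :
    (ℬ₁ ∩ ℬ₂).ncard ≠ kiteB v - 1 := by
  intro h
  have hcov : ∀ ℬ : Set (⊤ : SimpleGraph (Fin v)).Subgraph, IsPacking kite ℬ →
      ℬ.ncard = kiteB v → ∀ A : (⊤ : SimpleGraph (Fin v)).Subgraph, ∀ e ∈ A.edgeSet,
      ∃ B ∈ ℬ, e ∈ B.edgeSet := by
    intro ℬ hℬ hn A e he
    have h1 : (⋃ B ∈ ℬ, B.edgeSet) = (⊤ : SimpleGraph (Fin v)).edgeSet := by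
      refine Set.eq_of_subset_of_ncard_le (Set.iUnion₂_subset fun B _ => B.edgeSet_subset) ?_
        (Set.toFinite _)
      rw [hℬ.ncard_iUnion_edgeSet, ncard_edgeSet_top, hn, hv]
    have h2 := A.edgeSet_subset he
    rw [← h1] at h2
    simpa using h2
  have hdiff : ∀ ℬ ℬ' : Set (⊤ : SimpleGraph (Fin v)).Subgraph, ℬ.ncard = kiteB v →
      (ℬ ∩ ℬ').ncard = kiteB v - 1 → ∃ B, ℬ \ ℬ' = {B} := by
    intro ℬ ℬ' hn hi
    have := Set.ncard_inter_add_ncard_sdiff_eq_ncard ℬ ℬ' (Set.toFinite _)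
    exact Set.ncard_eq_one.1 (by omega)
  obtain ⟨B₁, hB₁⟩ := hdiff ℬ₁ ℬ₂ hn₁ h
  obtain ⟨B₂, hB₂⟩ := hdiff ℬ₂ ℬ₁ hn₂ (by rwa [Set.inter_comm])
  have key : ∀ (ℬ ℬ' : Set (⊤ : SimpleGraph (Fin v)).Subgraph) (B B'), IsPacking kite ℬ →
      IsPacking kite ℬ' → ℬ'.ncard = kiteB v → ℬ \ ℬ' = {B} → ℬ' \ ℬ = {B'} →
      B.edgeSet ⊆ B'.edgeSet := by
    intro ℬ ℬ' B B' hℬ hℬ' hn hB hB' e he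
    have hBm : B ∈ ℬ \ ℬ' := hB ▸ rfl
    obtain ⟨C, hC, heC⟩ := hcov ℬ' hℬ' hn B e he
    by_cases hC' : C ∈ ℬ
    · exact absurd (hℬ.eq_of_mem hBm.1 hC' he heC ▸ hC) hBm.2
    · have : C ∈ ℬ' \ ℬ := ⟨hC, hC'⟩
      rw [hB', Set.mem_singleton_iff] at this
      exact this ▸ heC
  have heq : B₁.edgeSet = B₂.edgeSet :=
    (key _ _ _ _ h₁ h₂ hn₂ hB₁ hB₂).antisymm (key _ _ _ _ h₂ h₁ hn₁ hB₂ hB₁)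
  have hm₁ : B₁ ∈ ℬ₁ \ ℬ₂ := hB₁ ▸ rfl
  have hm₂ : B₂ ∈ ℬ₂ \ ℬ₁ := hB₂ ▸ rfl
  obtain ⟨k, hk, hk'⟩ := exists_toSubgraph_of_iso (h₁.iso B₁ hm₁.1)
  obtain ⟨l, hl, hl'⟩ := exists_toSubgraph_of_iso (h₂.iso B₂ hm₂.1)
  rw [hk', hl', edgeSet_toSubgraph hk, edgeSet_toSubgraph hl] at heq
  have := toSubgraph_injective hk hl heq
  exact hm₁.2 (by rw [hk', this, ← hl']; exact hm₂.1)

theorem kiteFin_eq_of_flexible {v : ℕ} (h : Flexible false (⊤ : SimpleGraph (Fin v)).edgeSet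
    (kiteB v)) : kiteFin v = kiteAdm v := by
  ext ⟨s, t⟩
  constructor
  · rintro ⟨ℬ₁, ℬ₂, h₁, h₂, -, ht⟩
    change s + t ≤ kiteB v
    rw [← ht]
    exact (Set.ncard_le_ncard Set.inter_subset_left (Set.toFinite _)).trans
      (h₁.isPacking.ncard_triangles_le.trans h₁.isPacking.ncard_le)
  · intro hst
    have := mem_kiteFin_of_realizes (h s (s + t) (by omega) hst (by simp)) (by omega)
    rwa [Nat.add_sub_cancel_left] at this

theorem kiteFin_eq_of_flexible_tight {v : ℕ} (hv : 4 * kiteB v = v * (v - 1) / 2)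
    (hb : 1 ≤ kiteB v) (h : Flexible true (⊤ : SimpleGraph (Fin v)).edgeSet (kiteB v)) :
    kiteFin v = kiteAdm v \ {(kiteB v - 1, 0), (kiteB v - 1, 1)} := by
  have hfull := mem_kiteFin_of_realizes (h (kiteB v) (kiteB v) le_rfl le_rfl (by omega)) le_rfl
  -- There is a packing with `kiteB v` blocks, so all maximum packings have `kiteB v` blocks.
  obtain ⟨𝒜, _, h𝒜, -, h𝒜', -⟩ := hfull
  have h𝒜n : kiteB v ≤ 𝒜.ncard :=
    h𝒜'.symm.le.trans (Set.ncard_le_ncard Set.inter_subset_left (Set.toFinite _))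
  have hn : ∀ ℬ : Set (⊤ : SimpleGraph (Fin v)).Subgraph, IsMaximumPacking kite ℬ →
      ℬ.ncard = kiteB v := fun ℬ hℬ =>
    le_antisymm hℬ.isPacking.ncard_le (h𝒜n.trans (hℬ.maximum 𝒜 h𝒜.isPacking))
  ext ⟨s, t⟩
  constructor
  · rintro ⟨ℬ₁, ℬ₂, h₁, h₂, hs, ht⟩
    refine ⟨?_, ?_⟩
    · change s + t ≤ kiteB v
      rw [← ht]
      exact (Set.ncard_le_ncard Set.inter_subset_left (Set.toFinite _)).trans
        (h₁.isPacking.ncard_triangles_le.trans h₁.isPacking.ncard_le)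
    · have := ncard_inter_ne hv hb h₁.isPacking h₂.isPacking (hn _ h₁) (hn _ h₂)
      simp only at hs
      rw [hs] at this
      simp [this]
  · rintro ⟨hst, hne⟩
    change s + t ≤ kiteB v at hst
    have hs : s + 1 ≠ kiteB v := by
      intro hs
      simp only [Set.mem_insert_iff, Prod.mk.injEq, Set.mem_singleton_iff, not_or] at hne
      omega
    have := mem_kiteFin_of_realizes (h s (s + t) (by omega) hst fun _ => hs) (by omega)
    rwa [Nat.add_sub_cancel_left] at this

/-! ### Kite families of complete multipartite graphs with groups of size two -/

/-- A family of kites, given by tuples, that are pairwise edge-disjoint. -/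
structure IsKiteFamily {J Q : Type*} (κ : J → Q × Q × Q × Q) : Prop where
  tuple : ∀ j, IsKiteTuple (κ j)
  eq_of_mem : ∀ i j e, e ∈ kiteEdges (κ i) → e ∈ kiteEdges (κ j) → i = j

/-- A set of representatives of the nonzero elements of `ZMod m` up to sign, `m` odd. -/
theorem exists_half_system {m h : ℕ} (hm : m = 2 * h + 1) (hh : 1 ≤ h) :
    (∀ x : ZMod m, x + x = 0 → x = 0) ∧ (1 : ZMod m) ≠ 0 ∧ ∃ H : Finset (ZMod m),
      H.card = h ∧ 1 ∈ H ∧ ∀ y ∈ H, ∀ z ∈ H, y + z ≠ 0 := by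
  have hm1 : (m : ZMod m) = 0 := ZMod.natCast_self m
  refine ⟨fun x hx => ?_, ?_, (Finset.range h).image fun i => ((i + 1 : ℕ) : ZMod m), ?_, ?_, ?_⟩
  · have h1 : ((2 * h + 1 : ℕ) : ZMod m) = 0 := by rw [← hm, hm1]
    push_cast at h1
    linear_combination (h + 1 : ZMod m) * hx - x * h1
  · have h1 : ((1 : ℕ) : ZMod m) ≠ 0 := by
      rw [Ne, ZMod.natCast_eq_zero_iff]
      intro h1
      have := Nat.le_of_dvd one_pos h1
      omega
    simpa using h1
  · rw [Finset.card_image_of_injOn, Finset.card_range]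
    intro i hi j hj hij
    simp only [Finset.coe_range, Set.mem_Iio] at hi hj
    have := (ZMod.natCast_eq_natCast_iff' _ _ _).1 hij
    rw [Nat.mod_eq_of_lt (by omega), Nat.mod_eq_of_lt (by omega)] at this
    omega
  · exact Finset.mem_image.2 ⟨0, Finset.mem_range.2 hh, by simp⟩
  · intro y hy z hz
    obtain ⟨i, hi, rfl⟩ := Finset.mem_image.1 hy
    obtain ⟨j, hj, rfl⟩ := Finset.mem_image.1 hz
    rw [Finset.mem_range] at hi hj
    rw [← Nat.cast_add, Ne, ZMod.natCast_eq_zero_iff]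
    intro h1
    have := Nat.le_of_dvd (by omega) h1
    omega

/-- The kites for an odd number of groups. The groups are the elements of `R = ZMod m`. The
triangle joins two points on level `false` to their midpoint on level `true`; the pendant edge
lies on level `true`. -/
def oddKite {R : Type*} [CommRing R] (k : R × R) :
    (R × Bool) × (R × Bool) × (R × Bool) × (R × Bool) :=
  ((k.1 - k.2, false), (k.1 + k.2, false), (k.1, true), (k.1 + k.2, true))

/-- The four edges of `oddKite (c, y)` join points whose differences between the groups are `2 y`
on level `false`, `y` and `-y` from level `false` to level `true`, and `y` on level `true`. As `y`
runs through a half-system, each of these classes of edges occurs only once. -/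
theorem isKiteFamily_oddKite {R : Type*} [CommRing R] [DecidableEq R] {H : Finset R}
    (h2 : ∀ x : R, x + x = 0 → x = 0) (hH : ∀ y ∈ H, ∀ z ∈ H, y + z ≠ 0) :
    IsKiteFamily (fun k : R × H => oddKite (k.1, (k.2 : R))) ∧
      ∀ k : R × H, ∀ e ∈ kiteEdges (oddKite (k.1, (k.2 : R))),
        ¬ (Sym2.map Prod.fst e).IsDiag := by
  have h2' : ∀ x y : R, x + x ≠ y + y ∨ x = y := fun x y => by
    by_contra! h
    exact h.2 (sub_eq_zero.1 (h2 _ (by linear_combination h.1)))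
  have hne : ∀ y ∈ H, y ≠ 0 := fun y hy h0 => hH y hy y hy (by simp [h0])
  refine ⟨⟨?_, ?_⟩, ?_⟩
  · rintro ⟨c, y, hy⟩
    have := hH y hy y hy
    simp only [IsKiteTuple, oddKite, List.nodup_cons, List.mem_cons, List.not_mem_nil, or_false,
      not_or, not_false_eq_true, List.nodup_nil, and_true, Prod.mk.injEq]
    grind
  · rintro ⟨c, y, hy⟩ ⟨c', y', hy'⟩ e he he'
    have h3 := hH y hy y' hy'
    have h4 := h2' c c'
    simp only [kiteEdges, oddKite, List.mem_cons, List.not_mem_nil, or_false] at he he'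
    simp only [Prod.mk.injEq, Subtype.mk.injEq]
    rcases he with rfl | rfl | rfl | rfl <;>
      simp only [Sym2.eq_iff, Prod.mk.injEq, reduceCtorEq, and_false, and_true, false_or,
        or_false] at he' <;> grind
  · rintro ⟨c, y, hy⟩ e he
    have h3 := hH y hy y hy
    have h4 := hne y hy
    simp only [kiteEdges, oddKite, List.mem_cons, List.not_mem_nil, or_false] at he
    rcases he with rfl | rfl | rfl | rfl <;>
      simp only [Sym2.map_mk, Sym2.mk_isDiag_iff] <;> grind

/-- The kites for an even number of groups. The groups are the elements of `R = ZMod m` and one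
further group `none`. The kites `oddKite (c, 1)` are replaced by two families of kites, whose
triangles contain the two points of the group `none`. -/
def evenKite {R : Type*} [CommRing R] :
    (R × R) ⊕ R ⊕ R → (Option R × Bool) × (Option R × Bool) × (Option R × Bool) × (Option R × Bool)
  | .inl k => ((some (k.1 - k.2), false), (some (k.1 + k.2), false), (some k.1, true),
      (some (k.1 + k.2), true))
  | .inr (.inl c) => ((none, false), (some (c + 1), true), (some c, false), (some (c + 2), false))
  | .inr (.inr c) => ((none, true), (some c, false), (some (c - 1), true), (some c, true))

/-- Leaving out `y = 1` from the odd construction frees the edges between groups with difference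
`±2` on level `false`, `±1` between the levels, and `±1` on level `true`; the two families of kites
through `none` use these together with the edges at `none`. -/
theorem isKiteFamily_evenKite {R : Type*} [CommRing R] [DecidableEq R] {H : Finset R}
    (h2 : ∀ x : R, x + x = 0 → x = 0) (h1 : (1 : R) ≠ 0)
    (hH : ∀ y ∈ H, ∀ z ∈ H, y + z ≠ 0) (hH1 : ∀ y ∈ H, y ≠ 1 ∧ y + 1 ≠ 0) :
    IsKiteFamily (fun k : (R × H) ⊕ R ⊕ R => evenKite (k.map (Prod.map id Subtype.val) id)) ∧
      ∀ k : (R × H) ⊕ R ⊕ R, ∀ e ∈ kiteEdges (evenKite (k.map (Prod.map id Subtype.val) id)),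
        ¬ (Sym2.map Prod.fst e).IsDiag := by
  have h2' : ∀ x y : R, x + x ≠ y + y ∨ x = y := fun x y => by
    by_contra! h
    exact h.2 (sub_eq_zero.1 (h2 _ (by linear_combination h.1)))
  have hne : ∀ y ∈ H, y ≠ 0 := fun y hy h0 => hH y hy y hy (by simp [h0])
  have h3 : (1 : R) + 1 ≠ 0 := fun h => h1 (h2 _ h)
  have h4 : (1 + 1 : R) + (1 + 1) ≠ 0 := fun h => h3 (h2 _ h)
  refine ⟨⟨?_, ?_⟩, ?_⟩
  · rintro (⟨c, y, hy⟩ | c | c)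
    · have := hH y hy y hy
      simp only [IsKiteTuple, evenKite, Sum.map_inl, Prod.map, id, List.nodup_cons, List.mem_cons,
        List.not_mem_nil, or_false, not_or, not_false_eq_true, List.nodup_nil, and_true,
        Prod.mk.injEq, Option.some.injEq]
      grind
    · simp only [IsKiteTuple, evenKite, Sum.map_inr, id, List.nodup_cons, List.mem_cons,
        List.not_mem_nil, or_false, not_or, not_false_eq_true, List.nodup_nil, and_true,
        Prod.mk.injEq, Option.some.injEq]
      grind
    · simp only [IsKiteTuple, evenKite, Sum.map_inr, id, List.nodup_cons, List.mem_cons,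
        List.not_mem_nil, or_false, not_or, not_false_eq_true, List.nodup_nil, and_true,
        Prod.mk.injEq, Option.some.injEq]
      grind
  · have key : ∀ (c y : R) (hy : y ∈ H) (j : (R × H) ⊕ R ⊕ R) e,
        e ∈ kiteEdges (evenKite (.inl (c, y))) →
        e ∈ kiteEdges (evenKite (j.map (Prod.map id Subtype.val) id)) →
        Sum.inl (c, ⟨y, hy⟩) = j := by
      rintro c y hy (⟨c', y', hy'⟩ | c' | c') e he he'
      · have h5 := hH y hy y' hy'
        have h6 := h2' c c'
        simp only [kiteEdges, evenKite, Sum.map_inl, Prod.map, id, List.mem_cons,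
          List.not_mem_nil, or_false] at he he'
        simp only [Sum.inl.injEq, Prod.mk.injEq, Subtype.mk.injEq]
        rcases he with rfl | rfl | rfl | rfl <;>
          simp only [Sym2.eq_iff, Prod.mk.injEq, reduceCtorEq, and_false, and_true, false_or,
            or_false, Option.some.injEq] at he' <;> grind
      · have h5 := hH1 y hy
        have h6 := h2' y 1
        have h7 := h2' y (-1)
        simp only [kiteEdges, evenKite, Sum.map_inr, id, List.mem_cons,
          List.not_mem_nil, or_false] at he he'
        rcases he with rfl | rfl | rfl | rfl <;>
          simp only [Sym2.eq_iff, Prod.mk.injEq, reduceCtorEq, and_false, and_true, false_or,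
            or_false, false_and, Option.some.injEq] at he' <;> grind
      · have h5 := hH1 y hy
        simp only [kiteEdges, evenKite, Sum.map_inr, id, List.mem_cons,
          List.not_mem_nil, or_false] at he he'
        rcases he with rfl | rfl | rfl | rfl <;>
          simp only [Sym2.eq_iff, Prod.mk.injEq, reduceCtorEq, and_false, and_true, false_or,
            or_false, false_and, Option.some.injEq] at he' <;> grind
    have key' : ∀ (i j : R ⊕ R) e, e ∈ kiteEdges (evenKite (.inr i)) →
        e ∈ kiteEdges (evenKite (.inr j)) → i = j := by
      rintro (c | c) (c' | c') e he he' <;>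
        simp only [kiteEdges, evenKite, List.mem_cons, List.not_mem_nil, or_false] at he he' <;>
        rcases he with rfl | rfl | rfl | rfl <;>
        simp only [Sym2.eq_iff, Prod.mk.injEq, reduceCtorEq, and_false, and_true, false_or,
          or_false, false_and, Option.some.injEq, or_self, true_and] at he' <;> grind
    rintro (⟨c, y, hy⟩ | i) j e he he'
    · exact key c y hy j e he he'
    · rcases j with ⟨c, y, hy⟩ | j
      · exact (key c y hy (.inr i) e he' he).symm
      · exact congrArg _ (key' i j e he he')
  · rintro (⟨c, y, hy⟩ | c | c) e he
    · have h5 := hH y hy y hy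
      have h6 := hne y hy
      simp only [kiteEdges, evenKite, Sum.map_inl, Prod.map, id, List.mem_cons, List.not_mem_nil,
        or_false] at he
      rcases he with rfl | rfl | rfl | rfl <;>
        simp only [Sym2.map_mk, Sym2.mk_isDiag_iff] <;> grind
    · simp only [kiteEdges, evenKite, Sum.map_inr, id, List.mem_cons, List.not_mem_nil,
        or_false] at he
      rcases he with rfl | rfl | rfl | rfl <;>
        simp only [Sym2.map_mk, Sym2.mk_isDiag_iff] <;> grind
    · simp only [kiteEdges, evenKite, Sum.map_inr, id, List.mem_cons, List.not_mem_nil,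
        or_false] at he
      rcases he with rfl | rfl | rfl | rfl <;>
        simp only [Sym2.map_mk, Sym2.mk_isDiag_iff] <;> grind

/-- For `k ≥ 3` groups of size two, the edges between different groups can be partitioned into
`k (k - 1) / 2` kites. -/
theorem exists_kiteFamily (k : ℕ) (hk : 3 ≤ k) :
    ∃ (ι J : Type) (_ : Fintype ι) (_ : Fintype J) (_ : DecidableEq ι)
      (κ : J → (ι × Bool) × (ι × Bool) × (ι × Bool) × (ι × Bool)),
      Fintype.card ι = k ∧ 2 * Fintype.card J = k * (k - 1) ∧ IsKiteFamily κ ∧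
      ∀ j, ∀ e ∈ kiteEdges (κ j), ¬ (Sym2.map Prod.fst e).IsDiag := by
  rcases Nat.even_or_odd' k with ⟨h, rfl | rfl⟩
  · obtain ⟨h, rfl⟩ : ∃ h', h = h' + 1 := ⟨h - 1, by omega⟩
    obtain ⟨h2, h1, H, hHc, hH1, hH⟩ := exists_half_system (m := 2 * h + 1) rfl (by omega)
    obtain ⟨hF, ht⟩ := isKiteFamily_evenKite (H := H.erase 1) h2 h1
      (fun y hy z hz => hH y (Finset.mem_of_mem_erase hy) z (Finset.mem_of_mem_erase hz))
      (fun y hy => ⟨Finset.ne_of_mem_erase hy, hH y (Finset.mem_of_mem_erase hy) 1 hH1⟩)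
    refine ⟨Option (ZMod (2 * h + 1)), _, inferInstance, inferInstance, inferInstance, _, ?_, ?_,
      hF, ht⟩
    · rw [Fintype.card_option, ZMod.card]
      ring
    · obtain ⟨g, rfl⟩ : ∃ g, h = g + 1 := ⟨h - 1, by omega⟩
      rw [Fintype.card_sum, Fintype.card_sum, Fintype.card_prod, ZMod.card, Fintype.card_coe,
        Finset.card_erase_of_mem hH1, hHc, Nat.add_sub_cancel,
        show 2 * (g + 1 + 1) - 1 = 2 * g + 3 by omega]
      ring
  · obtain ⟨h2, -, H, hHc, -, hH⟩ := exists_half_system (m := 2 * h + 1) rfl (by omega)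
    obtain ⟨hF, ht⟩ := isKiteFamily_oddKite h2 hH
    refine ⟨ZMod (2 * h + 1), _, inferInstance, inferInstance, inferInstance, _, ZMod.card _, ?_,
      hF, ht⟩
    rw [Fintype.card_prod, ZMod.card, Fintype.card_coe, hHc, Nat.add_sub_cancel]
    ring

/-! ### Doubling the vertices -/

theorem map_fst_mem_kiteEdges {Q B : Type*} (k : Q × Q × Q × Q) (w x y z : B)
    {e : Sym2 (Q × B)}
    (he : e ∈ kiteEdges ((k.1, w), (k.2.1, x), (k.2.2.1, y), (k.2.2.2, z))) :
    Sym2.map Prod.fst e ∈ kiteEdges k := by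
  have := kiteEdges_map Prod.fst ((k.1, w), (k.2.1, x), (k.2.2.1, y), (k.2.2.2, z))
  rw [show kiteEdges k = _ from this]
  exact List.mem_map_of_mem he

/-- Doubling every vertex turns a kite into four edge-disjoint kites: the triangles come from the
Latin square `xor` of order two. -/
def doubleKite {Q : Type*} (k : Q × Q × Q × Q) (i j : Bool) :
    (Q × Bool) × (Q × Bool) × (Q × Bool) × (Q × Bool) :=
  ((k.1, i), (k.2.1, j), (k.2.2.1, xor i j), (k.2.2.2, i))

theorem IsKiteFamily.double {J Q : Type*} {κ : J → Q × Q × Q × Q} (h : IsKiteFamily κ) :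
    IsKiteFamily fun j : J × Bool × Bool => doubleKite (κ j.1) j.2.1 j.2.2 := by
  refine ⟨?_, ?_⟩
  · rintro ⟨j, x, y⟩
    have := h.tuple j
    simp only [IsKiteTuple, doubleKite, List.nodup_cons, List.mem_cons, List.not_mem_nil, or_false,
      not_or, not_false_eq_true, List.nodup_nil, and_true, Prod.mk.injEq] at this ⊢
    tauto
  · rintro ⟨i, x, y⟩ ⟨j, x', y'⟩ e he he'
    obtain rfl := h.eq_of_mem i j _ (map_fst_mem_kiteEdges _ _ _ _ _ he)
      (map_fst_mem_kiteEdges _ _ _ _ _ he')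
    have := h.tuple i
    simp only [IsKiteTuple, List.nodup_cons, List.mem_cons, List.not_mem_nil, or_false,
      not_or, not_false_eq_true, List.nodup_nil, and_true] at this
    simp only [kiteEdges, doubleKite, List.mem_cons, List.not_mem_nil, or_false] at he he'
    simp only [Prod.mk.injEq, true_and]
    rcases he with rfl | rfl | rfl | rfl <;>
      simp only [Sym2.eq_iff, Prod.mk.injEq] at he' <;>
      cases x <;> cases y <;> cases x' <;> cases y' <;> grind

/-- The edges above the edges of a kite, after doubling every vertex, form a unit with four
blocks. The three kite systems are the doubled kite, the one with its pendant edges interchanged,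
and the one from the other Latin square of order two. -/
theorem isKiteUnit_double {Q : Type*} [DecidableEq Q] {k : Q × Q × Q × Q} (hk : IsKiteTuple k) :
    IsKiteUnit {e : Sym2 (Q × Bool) | Sym2.map Prod.fst e ∈ kiteEdges k} 4 := by
  obtain ⟨a, b, c, d⟩ := k
  simp only [IsKiteTuple, List.nodup_cons, List.mem_cons, List.not_mem_nil, or_false,
    not_or, not_false_eq_true, List.nodup_nil, and_true] at hk
  obtain ⟨h1, h2⟩ := isKiteUnit_of_unitCheck (v := 8) (w := 0) (n := 4)
    (L := [[(0, 2, 4, 6), (1, 3, 4, 7), (0, 3, 5, 6), (1, 2, 5, 7)],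
      [(0, 2, 4, 7), (1, 3, 4, 6), (0, 3, 5, 7), (1, 2, 5, 6)],
      [(0, 2, 5, 6), (1, 3, 5, 7), (0, 3, 4, 6), (1, 2, 4, 7)]]) (by decide)
  -- The copies of `a`, `b`, `c`, `d` are `0, 1`, then `2, 3`, then `4, 5`, then `6, 7`.
  let f : ℕ → Q × Bool := fun n =>
    (if n < 2 then a else if n < 4 then b else if n < 6 then c else d, n % 2 == 0)
  refine (h1.map (f := f) (S := {n | n < 8}) (fun e he => (h2 he).2.1) ?_).mono ?_
  · intro m hm n hn hmn
    simp only [Set.mem_ofPred_eq] at hm hn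
    simp only [f, Prod.mk.injEq] at hmn
    obtain ⟨hmn1, hmn2⟩ := hmn
    have : m % 2 = n % 2 := by
      rcases Nat.mod_two_eq_zero_or_one m with h | h <;>
        rcases Nat.mod_two_eq_zero_or_one n with h' | h' <;> simp_all
    grind
  · rintro - ⟨e, ⟨P, hP, k, hk, he⟩, rfl⟩
    simp only [List.mem_cons, List.not_mem_nil, or_false] at hP
    rcases hP with rfl | rfl | rfl <;>
      simp only [List.mem_cons, List.not_mem_nil, or_false] at hk <;>
      rcases hk with rfl | rfl | rfl | rfl <;>
      simp only [kiteEdges, List.mem_cons, List.not_mem_nil, or_false] at he <;>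
      rcases he with rfl | rfl | rfl | rfl <;>
      simp [f, kiteEdges]

/-! ### Joining the groups -/

/-- The edges of a block are not loops, so a kite system always lives in the complete graph. -/
theorem Realizes.edgeSet_top {V : Type*} [DecidableEq V] {E : Set (Sym2 V)} {n s u : ℕ}
    (h : Realizes E n s u) : Realizes (⊤ : SimpleGraph V).edgeSet n s u := by
  have key : ∀ P : Finset (KiteBlock V), IsKiteSystem E P →
      IsKiteSystem (⊤ : SimpleGraph V).edgeSet P := by
    refine fun P hP => ⟨hP.exists_tuple, fun p hp e he => ?_, hP.eq_of_mem⟩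
    obtain ⟨k, hk, rfl⟩ := hP.exists_tuple p hp
    rw [mem_edges_kiteBlock hk] at he
    obtain ⟨a, b, c, d⟩ := k
    simp only [IsKiteTuple, List.nodup_cons, List.mem_cons, List.not_mem_nil, or_false, not_or,
      not_false_eq_true, List.nodup_nil, and_true] at hk
    simp only [kiteEdges, List.mem_cons, List.not_mem_nil, or_false] at he
    rcases he with rfl | rfl | rfl | rfl <;>
      simp only [SimpleGraph.mem_edgeSet, SimpleGraph.top_adj, Ne] <;> tauto
  obtain ⟨P, Q, hP, hQ, h⟩ := h
  exact ⟨P, Q, key P hP, key Q hQ, h⟩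

/-- A flexible edge set whose vertices embed into `Fin v` makes the complete graph on `Fin v`
flexible. -/
theorem Flexible.edgeSet_top {V : Type*} [DecidableEq V] {t : Bool} {E : Set (Sym2 V)} {n v : ℕ}
    {f : V → Fin v} {S : Set V} (h : Flexible t E n) (hE : ∀ e ∈ E, ∀ x ∈ e, x ∈ S)
    (hf : Set.InjOn f S) : Flexible t (⊤ : SimpleGraph (Fin v)).edgeSet n :=
  fun s u hs hu ht => (h.map hE hf s u hs hu ht).edgeSet_top

theorem flexible_top_of_edgesOutside {t : Bool} {v n : ℕ} (hv : 0 < v)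
    (h : Flexible t (edgesOutside v 0) n) :
    Flexible t (⊤ : SimpleGraph (Fin v)).edgeSet n := by
  refine h.edgeSet_top (f := fun i => ⟨i % v, Nat.mod_lt _ hv⟩) (S := {i | i < v})
    (fun e he => he.2.1) ?_
  intro i hi j hj hij
  simpa only [Fin.mk.injEq, Nat.mod_eq_of_lt hi, Nat.mod_eq_of_lt hj] using hij

/-- The vertices: `e` common points, and for every `x : ι` a group of eight points. -/
abbrev GroupVertex (ι : Type) (e : ℕ) := (((ι × Bool) × Bool) × Bool) ⊕ Fin e

/-- The embedding of `{0, …, e + 7}` onto the common points and the group of `x`. The common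
points come first. -/
def groupEmb {ι : Type} {e : ℕ} (x : ι) (i : ℕ) : GroupVertex ι e :=
  if h : i < e then .inr ⟨i, h⟩
  else .inl (((x, (i - e).testBit 0), (i - e).testBit 1), (i - e).testBit 2)

theorem groupEmb_eq_inl {ι : Type} {e : ℕ} {x : ι} {i : ℕ} {p : ((ι × Bool) × Bool) × Bool}
    (h : groupEmb (e := e) x i = .inl p) : p.1.1.1 = x := by
  unfold groupEmb at h
  split_ifs at h
  obtain rfl := Sum.inl_injective h
  rfl

theorem injOn_groupEmb {ι : Type} {e : ℕ} (x : ι) :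
    Set.InjOn (groupEmb (e := e) x) {i | i < 8 + e} := by
  have key : ∀ i < 8, ∀ j < 8, i.testBit 0 = j.testBit 0 → i.testBit 1 = j.testBit 1 →
      i.testBit 2 = j.testBit 2 → i = j := by decide
  intro i hi j hj hij
  simp only [Set.mem_ofPred_eq] at hi hj
  unfold groupEmb at hij
  split_ifs at hij with h1 h2 h2
  · simpa using hij
  · simp only [Sum.inl.injEq, Prod.mk.injEq, true_and] at hij
    have := key (i - e) (by omega) (j - e) (by omega) hij.1.1 hij.1.2 hij.2
    omega

/-- The constructions on `8 + e` vertices extend to `8 k + e` vertices, `k ≥ 3`: the first group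
and the common points carry a complete graph, the other groups carry units, and so do the
edges between different groups. -/
theorem flexible_groups {t : Bool} {e n m k : ℕ} (hk : 3 ≤ k)
    (hE : Flexible t (edgesOutside (8 + e) 0) n) (hn : 7 ≤ n)
    (hF : ∃ F, IsKiteUnit F m ∧ F ⊆ edgesOutside (8 + e) e) (hm : 2 ≤ m) (hm' : m ≤ 21) :
    Flexible t (⊤ : SimpleGraph (Fin (8 * k + e))).edgeSet
      (n + 8 * (k * (k - 1)) + (k - 1) * m) := by
  obtain ⟨ι, J, _, _, _, κ, hι, hJ, hκ, hκ'⟩ := exists_kiteFamily k hk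
  obtain ⟨F, hF, hF'⟩ := hF
  have : Nonempty ι := Fintype.card_pos_iff.1 (by omega)
  let x₀ : ι := Classical.arbitrary ι
  let emb : ι → ℕ → GroupVertex ι e := groupEmb
  let C : J × Bool × Bool → Set (Sym2 (GroupVertex ι e)) := fun j =>
    Sym2.map Sum.inl '' {d | Sym2.map Prod.fst d ∈ kiteEdges (doubleKite (κ j.1) j.2.1 j.2.2)}
  let H : {x : ι // x ≠ x₀} → Set (Sym2 (GroupVertex ι e)) := fun x => Sym2.map (emb x) '' F
  -- The three kinds of edges are told apart by the groups of their ends: the edges of `C j` meet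
  -- two groups, the edges of `H x` meet the group of `x` and no other one.
  have hC : ∀ j, ∀ d ∈ C j, ∃ p q, Sum.inl p ∈ d ∧ Sum.inl q ∈ d ∧ p.1.1.1 ≠ q.1.1.1 := by
    rintro j - ⟨d, hd, rfl⟩
    have h1 := hκ' j.1 _ (map_fst_mem_kiteEdges _ _ _ _ _ hd)
    induction d using Sym2.ind with
    | _ p q => exact ⟨p, q, by simp, by simp, by simpa using h1⟩
  have hin : ∀ x, ∀ d : Sym2 ℕ, ∀ p, Sum.inl p ∈ Sym2.map (emb x) d → p.1.1.1 = x := by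
    intro x d p hp
    obtain ⟨i, -, hi⟩ := Sym2.mem_map.1 hp
    exact groupEmb_eq_inl hi
  have hH : ∀ x, ∀ d ∈ H x, ∃ p, Sum.inl p ∈ d ∧ p.1.1.1 = x.1 := by
    rintro x - ⟨d, hd, rfl⟩
    obtain ⟨-, -, i, hi, hie⟩ := hF' hd
    refine ⟨_, Sym2.mem_map.2 ⟨i, hi, dif_neg (Nat.not_lt.2 hie)⟩, rfl⟩
  have hCn : ∀ x, ∀ d : Sym2 ℕ, ∀ j, Sym2.map (emb x) d ∉ C j := by
    intro x d j hd
    obtain ⟨p, q, hp, hq, hpq⟩ := hC j _ hd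
    exact hpq ((hin x d p hp).trans (hin x d q hq).symm)
  have hHn : ∀ x, ∀ d : Sym2 ℕ, ∀ y : {x : ι // x ≠ x₀}, Sym2.map (emb x) d ∈ H y → y.1 = x := by
    intro x d y hd
    obtain ⟨p, hp, hpy⟩ := hH y _ hd
    exact hpy.symm.trans (hin x d p hp)
  have hcard : Fintype.card {x : ι // x ≠ x₀} = k - 1 := by
    rw [Fintype.card_subtype_compl, Fintype.card_subtype_eq, hι]
  have hcard' : Fintype.card (J × Bool × Bool) * 4 = 8 * (k * (k - 1)) := by
    rw [Fintype.card_prod, Fintype.card_prod, Fintype.card_bool, ← hJ]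
    ring
  -- Hence `n + 8 * (k * (k - 1)) ≥ 7 + 48`, which leaves room for units with `m ≤ 21` blocks.
  have hkk : 3 * 2 ≤ k * (k - 1) := Nat.mul_le_mul hk (by omega)
  have h1 : Flexible t (Sym2.map (emb x₀) '' edgesOutside (8 + e) 0) n :=
    hE.map (fun d hd => hd.2.1) (injOn_groupEmb x₀)
  have h2 : Flexible t ((Sym2.map (emb x₀) '' edgesOutside (8 + e) 0) ∪ ⋃ j, C j)
      (n + 8 * (k * (k - 1))) := by
    rw [← hcard']
    refine h1.iUnion_unit (F := C) (fun j => ?_) (fun j => ?_) ?_ (by norm_num) (by omega)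
    · exact (isKiteUnit_double (hκ.double.tuple j)).map (S := Set.univ)
        (fun _ _ _ _ => Set.mem_univ _) Sum.inl_injective.injOn
    · rw [Set.disjoint_left]
      rintro - ⟨d, -, rfl⟩ hd
      exact hCn x₀ d j hd
    · rintro i j - ⟨d, hd, rfl⟩ ⟨d', hd', h⟩
      obtain rfl := Sym2.map.injective Sum.inl_injective h
      exact hκ.double.eq_of_mem i j _ hd hd'
  have h3 : Flexible t (((Sym2.map (emb x₀) '' edgesOutside (8 + e) 0) ∪ ⋃ j, C j) ∪ ⋃ x, H x)
      (n + 8 * (k * (k - 1)) + (k - 1) * m) := by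
    rw [show (k - 1) * m = Fintype.card {x : ι // x ≠ x₀} * m by rw [hcard]]
    refine h2.iUnion_unit (F := H) (fun x => ?_) (fun x => ?_) ?_ hm (by omega)
    · exact hF.map (fun d hd => (hF' hd).2.1) (injOn_groupEmb x.1)
    · rw [Set.disjoint_left]
      rintro d₀ (⟨d, -, rfl⟩ | hd) hd'
      · exact x.2 (hHn x₀ d x hd')
      · obtain ⟨j, hj⟩ := Set.mem_iUnion.1 hd
        obtain ⟨d, -, rfl⟩ := hd'
        exact hCn x d j hj
    · rintro x y - ⟨d, -, rfl⟩ hd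
      exact Subtype.ext (hHn x d y hd).symm
  have hW : Fintype.card (GroupVertex ι e) = 8 * k + e := by
    simp only [Fintype.card_sum, Fintype.card_prod, Fintype.card_bool, Fintype.card_fin, hι]
    ring
  exact h3.edgeSet_top (f := Fintype.equivFinOfCardEq hW) (S := Set.univ)
    (fun _ _ _ _ => Set.mem_univ _) (Equiv.injective _).injOn

theorem kiteB_eight_mul_add {k : ℕ} (hk : 1 ≤ k) (e : ℕ) :
    kiteB (8 * k + e) = kiteB (8 + e) + 8 * (k * (k - 1)) + (k - 1) * (7 + 2 * e) := by
  obtain ⟨k, rfl⟩ : ∃ j, k = j + 1 := ⟨k - 1, by omega⟩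
  unfold kiteB
  rw [show 8 * (k + 1) + e - 1 = 8 * k + e + 7 by omega, show 8 + e - 1 = e + 7 by omega,
    Nat.add_sub_cancel, show (8 * (k + 1) + e) * (8 * k + e + 7) =
      (8 + e) * (e + 7) + (8 * ((k + 1) * k) + k * (7 + 2 * e)) * 8 by ring,
    Nat.add_mul_div_right _ _ (by norm_num), Nat.add_assoc]

/-- Complete graphs on `8, …, 15` vertices, and the units with `e` common points that extend
them. -/
theorem flexible_base {e : ℕ} (he : e < 8) :
    Flexible (decide (e < 2)) (edgesOutside (8 + e) 0) (kiteB (8 + e)) ∧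
      ∃ F, IsKiteUnit F (7 + 2 * e) ∧ F ⊆ edgesOutside (8 + e) e := by
  interval_cases e
  · exact ⟨flexible_complete_8, isKiteUnit_hole_0⟩
  · exact ⟨flexible_complete_9, isKiteUnit_hole_1⟩
  · exact ⟨flexible_complete_10, isKiteUnit_hole_2⟩
  · exact ⟨flexible_complete_11, isKiteUnit_hole_3⟩
  · exact ⟨flexible_complete_12, isKiteUnit_hole_4⟩
  · exact ⟨flexible_complete_13, isKiteUnit_hole_5⟩
  · exact ⟨flexible_complete_14, isKiteUnit_hole_6⟩
  · exact ⟨flexible_complete_15, isKiteUnit_hole_7⟩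

theorem flexible_small {v : ℕ} (h4 : 4 ≤ v) (h : v < 24) :
    Flexible (decide (v % 8 < 2)) (edgesOutside v 0) (kiteB v) := by
  interval_cases v
  · exact flexible_complete_4
  · exact flexible_complete_5
  · exact flexible_complete_6
  · exact flexible_complete_7
  · exact flexible_complete_8
  · exact flexible_complete_9
  · exact flexible_complete_10
  · exact flexible_complete_11
  · exact flexible_complete_12
  · exact flexible_complete_13
  · exact flexible_complete_14
  · exact flexible_complete_15
  · exact flexible_complete_16
  · exact flexible_complete_17
  · exact flexible_complete_18
  · exact flexible_complete_19
  · exact flexible_complete_20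
  · exact flexible_complete_21
  · exact flexible_complete_22
  · exact flexible_complete_23

theorem flexible_top {v : ℕ} (hv : 4 ≤ v) :
    Flexible (decide (v % 8 < 2)) (⊤ : SimpleGraph (Fin v)).edgeSet (kiteB v) := by
  rcases Nat.lt_or_ge v 24 with h | h
  · exact flexible_top_of_edgesOutside (by omega) (flexible_small hv h)
  · obtain ⟨k, e, he, rfl⟩ : ∃ k e, e < 8 ∧ v = 8 * k + e :=
      ⟨v / 8, v % 8, Nat.mod_lt _ (by norm_num), (Nat.div_add_mod v 8).symm⟩
    obtain ⟨h1, h2⟩ := flexible_base he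
    rw [Nat.mul_add_mod, Nat.mod_eq_of_lt he, kiteB_eight_mul_add (by omega) e]
    refine flexible_groups (by omega) h1 ?_ h2 (by omega) (by omega)
    rw [kiteB, Nat.le_div_iff_mul_le (by norm_num)]
    exact le_trans (by norm_num) (Nat.mul_le_mul (show 8 ≤ 8 + e by omega)
      (show 7 ≤ 8 + e - 1 by omega))

theorem theorem1p2 :
    (∀ v : ℕ, 8 ≤ v → (v ≡ 0 [MOD 8] ∨ v ≡ 1 [MOD 8]) →
      kiteFin v = kiteAdm v \ {(kiteB v - 1, 0), (kiteB v - 1, 1)}) ∧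
    (∀ v : ℕ, 4 ≤ v → (∃ r ∈ ({2, 3, 4, 5, 6, 7} : Set ℕ), v ≡ r [MOD 8]) →
      kiteFin v = kiteAdm v) := by
  refine ⟨fun v hv h => ?_, fun v hv h => ?_⟩
  · have hmod : v % 8 < 2 := by
      rcases h with h | h <;> rw [Nat.ModEq] at h <;> omega
    have hdvd : 8 ∣ v * (v - 1) := by
      rcases h with h | h
      · exact ((Nat.modEq_zero_iff_dvd.1 h)).mul_right _
      · exact ((Nat.modEq_iff_dvd' (by omega)).1 h.symm).mul_left _
    have h8 : 8 * 7 ≤ v * (v - 1) := Nat.mul_le_mul hv (by omega)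
    have hf := flexible_top (v := v) (by omega)
    rw [decide_eq_true hmod] at hf
    exact kiteFin_eq_of_flexible_tight (by unfold kiteB; omega) (by unfold kiteB; omega) hf
  · have hmod : ¬ v % 8 < 2 := by
      obtain ⟨r, hr, h⟩ := h
      rw [Nat.ModEq] at h
      simp only [Set.mem_insert_iff, Set.mem_singleton_iff] at hr
      omega
    have hf := flexible_top hv
    rw [decide_eq_false hmod] at hf
    exact kiteFin_eq_of_flexible hf
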